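/- **Notation.** For a prime $p$ let $\mathbb Z_{(p)}\subset\mathbb Q$ be the ring of fractions whose denominator in lowest terms is prime to $p$, and $v_p$ the $p$-adic valuation on $\mathbb Q$. For $\gamma\in\mathbb Z_{(p)}$ let $\mathfrak D_p(\gamma)$ be the unique element of $\mathbb Z_{(p)}$ with $p\,\mathfrak D_p(\gamma)-\gamma\in\{0,\dots,p-1\}$; $\mathfrak D_p^m$ is its $m$-fold iterate, applied to vectors entrywise. Let $(x)_i=x(x+1)\cdots(x+i-1)$. For $n\ge 1$, $\boldsymbol\alpha=(\alpha_1,\dots,\alpha_n)$ and $\boldsymbol\beta=(\beta_1,\dots,\beta_{n-1},\beta_n)$ with $\beta_n=1$ put $$\mathcal Q_{\boldsymbol\alpha,\boldsymbol\beta}(i)=\frac{(\alpha_1)_i\cdots(\alpha_n)_i}{(\beta_1)_i\cdots(\beta_{n-1})_i\,i!},\qquad {}_nF_{n-1}(\boldsymbol\alpha,\boldsymbol\beta;z)=\sum_{i\ge0}\mathcal Q_{\boldsymbol\alpha,\boldsymbol\beta}(i)z^i,$$ let $d=d_{\boldsymbol\alpha,\boldsymbol\beta}$ be the least common multiple of the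 denominators of all $\alpha_i,\beta_j$, and, if all parameters lie in $\mathbb Z_{(p)}$, let $$S_{\boldsymbol\alpha,\boldsymbol\beta,p}=\{r\in\{0,\dots,p-1\}:\ r\equiv 1-\beta_j \bmod p\text{ for some }1\le j\le n,\ \text{and } v_p(\mathcal Q_{\boldsymbol\alpha,\boldsymbol\beta}(r))=0\}.$$ The height of a rational function $s/t$ in lowest terms is $\max(\deg s,\deg t)$; the height of a polynomial over $\mathbb F_p(z)$ is the maximum of the heights of its coefficients. Congruences mod $p$ are in $\mathbb Z_{(p)}[[z]][z^{-1}]$, and $\varphi$ is Euler's totient function. **Theorem.** Let $n\ge1$, let $\boldsymbol\alpha=(\alpha_1,\dots,\alpha_n)$ and $\boldsymbol\beta=(\beta_1,\dots,\beta_{n-1},1)$ be in $(\mathbb Q\cap(0,1])^n$ with $\alpha_i-\beta_j\notin\mathbb Z$ for all $i,j\in\{1,\dots,n\}$ (where $\beta_n=1$), let $f={}_nF_{n-1}(\boldsymbol\alpha,\boldsymbol\beta;z)$, and let $\mathcal S$ be an infinite set of primes $p$ such that $p\nmid d$ and $f\in\mathbb Z_{(p)}[[z]]$. Then there is an infinite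 set $\mathcal S'\subset\mathcal S$ with $\mathcal S\setminus\mathcal S'$ finite such that, for every $p\in\mathcal S'$, there is a nonzero polynomial $P_p(Y)\in\mathbb F_p(z)[Y]$ of degree at most $p^{2n\varphi(d)}$ and height at most $5^n(n+1)!\,p^{2(n+1)\varphi(d)}$ with $P_p(f\bmod p)=0$. Moreover, if $p\in\mathcal S'$, $l$ is the order of $p$ in $(\mathbb Z/d\mathbb Z)^*$, and $N=\#S_{\mathfrak D_p^{l-1}(\boldsymbol\alpha),\mathfrak D_p^{l-1}(\boldsymbol\beta),p}$, then: 1. if $N=1$, then $f+Q_1f^{p^l}\equiv0\bmod p$ for some $Q_1\in\mathbb Z_{(p)}[z]$ of degree less than $p^l$; 2. if $N=2$, then $f+Q_1f^{p^l}+Q_2f^{p^{2l}}\equiv0\bmod p$ for some $Q_1,Q_2\in\mathbb Z_{(p)}(z)\cap\mathbb Z_{(p)}[[z]][z^{-1}]$ such that the heights of $Q_1\bmod p$ and $Q_2\bmod p$ are less than $2p^{2l}$; 3. if $N=t+1>2$, then $f+\sum_{i=1}^{t+1}Q_if^{p^{il}}\equiv0\bmod p$ for some $Q_1,\dots,Q_{t+1}\in\mathbb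 Z_{(p)}(z)\cap\mathbb Z_{(p)}[[z]][z^{-1}]$ such that the height of each $Q_i\bmod p$ is less than $5^t(t+1)!\,p^{2(t+1)l}$. -/

import Mathlib

noncomputable section

namespace HypMod

open Polynomial
open scoped RatFunc

/-- The localization `ℤ_(p)` of `ℤ` at the prime ideal `(p)`, as a set of rational numbers:
the fractions whose denominator in lowest terms is not divisible by `p`. -/
def zLocal (p : ℕ) : Set ℚ := {x | ¬ p ∣ x.den}

/-- `Q_{α,β}(i) = (α₁)ᵢ ⋯ (αₙ)ᵢ / ((β₁)ᵢ ⋯ (βₙ)ᵢ)` with Pochhammer symbols.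
For `βₙ = 1` the last factor of the denominator is `(1)ᵢ = i!`. -/
def hypCoeff {n : ℕ} (α β : Fin n → ℚ) (i : ℕ) : ℚ :=
  (∏ k, (ascPochhammer ℚ i).eval (α k)) / ∏ k, (ascPochhammer ℚ i).eval (β k)

/-- The hypergeometric series `∑ Q_{α,β}(i) zⁱ`. -/
def hypSeries {n : ℕ} (α β : Fin n → ℚ) : PowerSeries ℚ :=
  PowerSeries.mk (hypCoeff α β)

/-- The least common multiple `d_{α,β}` of the denominators of all `αᵢ` and `βⱼ`
(a parameter equal to `1` contributes the denominator `1`). -/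
def hypDenom {n : ℕ} (α β : Fin n → ℚ) : ℕ :=
  Nat.lcm (Finset.univ.lcm fun i => (α i).den) (Finset.univ.lcm fun j => (β j).den)

/-- Dwork's map `𝔇_p` (relevant on `ℤ_(p)` only): `𝔇_p(γ) = (γ + s) / p`, where
`s ∈ {0, …, p-1}` is the representative of `-γ mod p`; see `dwork_spec`.
The cast of a rational number to `ZMod p` is numerator over denominator, which on `ℤ_(p)`
is the reduction map `ℤ_(p) → 𝔽_p`. -/
def dwork (p : ℕ) [Fact p.Prime] (γ : ℚ) : ℚ :=
  (γ + ((-(γ : ZMod p)).val : ℚ)) / p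

/-- The set `E_{α,β,p}` (it depends on `β` and `p` only) of those `r ∈ {0, …, p-1}` whose class
mod `p` is an exponent at zero `1 - βⱼ mod p` of the hypergeometric operator reduced mod `p`.
As `βₙ = 1`, the exponent `0` is among them. -/
def expSet {n : ℕ} (β : Fin n → ℚ) (p : ℕ) [Fact p.Prime] : Finset ℕ :=
  open Classical in (Finset.range p).filter fun r => ∃ j, (r : ZMod p) = 1 - (β j : ZMod p)

/-- The set `S_{α,β,p}` of those `r ∈ E_{α,β,p}` with `v_p(Q_{α,β}(r)) = 0`. -/
def unitExpSet {n : ℕ} (α β : Fin n → ℚ) (p : ℕ) [Fact p.Prime] : Finset ℕ :=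
  (expSet β p).filter fun r => hypCoeff α β r ≠ 0 ∧ padicValRat p (hypCoeff α β r) = 0

/-- The number of elements of `S_{𝔇_p^m(α), 𝔇_p^m(β), p}`. -/
def numUnitExp {n : ℕ} (α β : Fin n → ℚ) (p : ℕ) [Fact p.Prime] (m : ℕ) : ℕ :=
  (unitExpSet (fun i => (dwork p)^[m] (α i)) (fun j => (dwork p)^[m] (β j)) p).card

/-- Height of a rational function written in lowest terms. -/
def ratHeight {F : Type*} [Field F] (a : RatFunc F) : ℕ :=
  max a.num.natDegree a.denom.natDegree

/-- Height of a polynomial over a rational function field. -/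
def polyHeight {F : Type*} [Field F] (P : (RatFunc F)[X]) : ℕ :=
  (Finset.range (P.natDegree + 1)).sup fun i => ratHeight (P.coeff i)

/-- Value at a Laurent series `g` of a polynomial with coefficients in `F(z)`, where `F(z)` is
embedded in `F((z))` by expansion at `z = 0`. -/
def evalLaurent {F : Type*} [Field F] (P : (RatFunc F)[X]) (g : LaurentSeries F) :
    LaurentSeries F :=
  aeval g P

/-- Reduction mod `p` of the Laurent series in `ℤ_(p)[[z]][z⁻¹]`, coefficient by coefficient. -/
def redLaurent (p : ℕ) [Fact p.Prime] (h : LaurentSeries ℚ) : LaurentSeries (ZMod p) :=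
  HahnSeries.map h (⟨fun x : ℚ => (x : ZMod p), Rat.cast_zero⟩ : ZeroHom ℚ (ZMod p))

/-- `h ∈ ℤ_(p)[[z]][z⁻¹]`. -/
def IsIntegralLaurent (p : ℕ) (h : LaurentSeries ℚ) : Prop :=
  ∀ k, h.coeff k ∈ zLocal p

/-- `h ≡ 0 mod p`, i.e. `h ∈ p ℤ_(p)[[z]][z⁻¹]`. -/
def IsZeroMod (p : ℕ) (h : LaurentSeries ℚ) : Prop :=
  ∀ k, ∃ u ∈ zLocal p, h.coeff k = p * u

/-- For `q ∈ ℚ(z)`: it lies in `ℤ_(p)(z) ∩ ℤ_(p)[[z]][z⁻¹]`, and its reduction mod `p`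
is a rational function over `𝔽_p` whose height is less than `H`. -/
def IsIntegralOfHeightLT (p : ℕ) [Fact p.Prime] (q : RatFunc ℚ) (H : ℕ) : Prop :=
  IsIntegralLaurent p (q : LaurentSeries ℚ) ∧
    ∃ r : RatFunc (ZMod p),
      (r : LaurentSeries (ZMod p)) = redLaurent p (q : LaurentSeries ℚ) ∧ ratHeight r < H

theorem den_cast_ne_zero {p : ℕ} {x : ℚ} (hx : x ∈ zLocal p) : (x.den : ZMod p) ≠ 0 := by
  rwa [Ne, ZMod.natCast_eq_zero_iff]

theorem natCast_mem_zLocal {p : ℕ} [hp : Fact p.Prime] (s : ℕ) : (s : ℚ) ∈ zLocal p := by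
  simpa [zLocal] using hp.out.one_lt.ne'

theorem add_mem_zLocal {p : ℕ} [hp : Fact p.Prime] {x y : ℚ}
    (hx : x ∈ zLocal p) (hy : y ∈ zLocal p) : x + y ∈ zLocal p := fun h =>
  (hp.out.dvd_mul.1 (h.trans (Rat.add_den_dvd x y))).elim hx hy

theorem div_mem_zLocal {p : ℕ} [hp : Fact p.Prime] {x : ℚ} (hx : x ∈ zLocal p)
    (h0 : (x : ZMod p) = 0) : x / p ∈ zLocal p := by
  have hd := den_cast_ne_zero hx
  rw [Rat.cast_def, div_eq_zero_iff, or_iff_left hd, ZMod.intCast_zmod_eq_zero_iff_dvd] at h0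
  obtain ⟨c, hc⟩ := h0
  have hp0 : (p : ℚ) ≠ 0 := by exact_mod_cast hp.out.ne_zero
  have hx' : x / p = Rat.divInt c x.den := by
    rw [Rat.divInt_eq_div, div_eq_iff hp0]
    conv_lhs => rw [← Rat.num_div_den x, hc]
    push_cast
    ring
  intro h
  rw [hx'] at h
  exact hx (by exact_mod_cast (Int.natCast_dvd_natCast.2 h).trans (Rat.den_dvd c x.den))

/-- For `γ ∈ ℤ_(p)`, `dwork p γ` is the unique element `δ` of `ℤ_(p)` such that
`p δ - γ ∈ {0, …, p-1}`. -/
theorem dwork_spec (p : ℕ) [hp : Fact p.Prime] {γ : ℚ} (hγ : γ ∈ zLocal p) (δ : ℚ) :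
    (δ ∈ zLocal p ∧ ∃ s < p, (p : ℚ) * δ - γ = (s : ℕ)) ↔ δ = dwork p γ := by
  have hp0 : (p : ℚ) ≠ 0 := by exact_mod_cast hp.out.ne_zero
  constructor
  · rintro ⟨hδ, s, hs, h⟩
    have h1 : γ + (s : ℚ) = (p : ℚ) * δ := by linarith
    have h2 : ((γ + (s : ℚ) : ℚ) : ZMod p) = 0 := by
      rw [h1, Rat.cast_mul_of_ne_zero (by simp) (den_cast_ne_zero hδ)]
      simp
    rw [Rat.cast_add_of_ne_zero (den_cast_ne_zero hγ) (by simp), Rat.cast_natCast] at h2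
    have h3 : (-(γ : ZMod p)).val = s := by
      rw [neg_eq_of_add_eq_zero_right h2, ZMod.val_natCast_of_lt hs]
    rw [dwork, h3, h1]
    field_simp
  · rintro rfl
    refine ⟨div_mem_zLocal (add_mem_zLocal hγ (natCast_mem_zLocal _)) ?_,
      (-(γ : ZMod p)).val, ZMod.val_lt _, ?_⟩
    · rw [Rat.cast_add_of_ne_zero (den_cast_ne_zero hγ) (by rw [Rat.den_natCast]; simp),
        Rat.cast_natCast,
        ZMod.natCast_zmod_val]
      simp
    · rw [dwork]
      field_simp
      ring

end HypMod

end

/-!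
Let `f` be the series, `d` the common denominator of the parameters and `p > d` a prime of `S`;
the finitely many other primes of `S` are discarded. Everything is read off from the reductions mod `p` of the coefficients `Q(i)`.

*Sections.* Among `p` consecutive factors of `(γ)ᵢ` exactly one is divisible by `p`, and these
factors are `p (𝔇_p(γ) + m)`. Hence, up to factors in `1 + p ℤ_(p)`, `Q(pm)` is the coefficient
`Q'(m)` for the parameters `𝔇_p(α), 𝔇_p(β)`, and `Q(a + pm)` is `Q(a) Q'(m)` times a quotient of
linear factors in `m` (`IsAdmissible.hypCoeff_shift`, `IsAdmissible.hypCoeff_mul_prime`). A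
denominator in this quotient that vanishes mod `p` is absorbed by replacing `Q'(m)` with
`Q'(m + 1)` (`IsAdmissible.exists_section_coeffFactor`). Moreover the quotients `Q(r + 1) / Q(r)`
are `p`-integral and periodic mod `p` unless `r + 1` is an exponent at zero. So each series
`∑ Q(a + pm) zᵐ mod p` has all its sections of order `p` among the multiples of the series
`∑ Q'(a' + pm) zᵐ mod p`, where `a'` runs over the set `unitExpSet` of the parameters `𝔇_p(α), 𝔇_p(β)`
(`IsAdmissible.exists_section`). As `𝔇_p^l` fixes the parameters, iteration shows that
`f mod p` is, for every `k`, an `𝔽_p[z]`-combination of the `p^{kl}`-th powers of `N` fixed series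
(`IsAdmissible.exists_combination`), with coefficients of degree less than `p^{kl}`. For `N = 1`
the only series is `f` itself, which is assertion (1).

*Elimination.* Put `q = p^l`. The `N + 1` series `f, f^q, …, f^{q^N}` are combinations of the
`q^N`-th powers of the `N` series, so a dimension count gives a linear relation between them whose
coefficients have degree less than `N q^N` (`exists_relation_of_card`). If the coefficient of `f`
vanishes, let `f^{q^k}` be the first power that occurs: a section of order `q^k` turns the relation
into one that starts with `f` and whose degrees are no larger
(`exists_relation_coeff_zero_ne_zero`). The bound `N q^N` implies all the stated bounds.

*Lifting.* A quotient `s / t` over `𝔽_p` is lifted by writing `t = zᵏ u` with `u(0) ≠ 0`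
and lifting `s` and `u`; the lift of `u` is a unit of `ℤ_(p)[[z]]` (`exists_lift_ratFunc`).
-/

noncomputable section

namespace HypMod

open Polynomial
open scoped RatFunc

/-! ### The ring of `p`-integral rational numbers -/

section

variable {p : ℕ} [hp : Fact p.Prime]

theorem neg_mem_zLocal {p : ℕ} {x : ℚ} (hx : x ∈ zLocal p) : -x ∈ zLocal p := by
  simpa [zLocal] using hx

theorem mul_mem_zLocal {x y : ℚ} (hx : x ∈ zLocal p) (hy : y ∈ zLocal p) :
    x * y ∈ zLocal p := fun h =>
  (hp.out.dvd_mul.1 (h.trans (Rat.mul_den_dvd x y))).elim hx hy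

/-- `ℤ_(p)` as a subring of `ℚ`. -/
def zLocalSubring (p : ℕ) [Fact p.Prime] : Subring ℚ where
  carrier := zLocal p
  mul_mem' := mul_mem_zLocal
  one_mem' := by simpa using natCast_mem_zLocal (p := p) 1
  add_mem' := add_mem_zLocal
  zero_mem' := by simpa using natCast_mem_zLocal (p := p) 0
  neg_mem' := neg_mem_zLocal

theorem cast_mul_zLocal {x y : ℚ} (hx : x ∈ zLocal p) (hy : y ∈ zLocal p) :
    ((x * y : ℚ) : ZMod p) = x * y :=
  Rat.cast_mul_of_ne_zero (den_cast_ne_zero hx) (den_cast_ne_zero hy)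

theorem cast_add_zLocal {x y : ℚ} (hx : x ∈ zLocal p) (hy : y ∈ zLocal p) :
    ((x + y : ℚ) : ZMod p) = x + y :=
  Rat.cast_add_of_ne_zero (den_cast_ne_zero hx) (den_cast_ne_zero hy)

/-- The reduction map `ℤ_(p) → 𝔽_p`. -/
def reduction (p : ℕ) [Fact p.Prime] : zLocalSubring p →+* ZMod p where
  toFun x := ((x : ℚ) : ZMod p)
  map_one' := by simp
  map_mul' x y := cast_mul_zLocal x.2 y.2
  map_zero' := by simp
  map_add' x y := cast_add_zLocal x.2 y.2

theorem prod_mem_zLocal {ι : Type*} (s : Finset ι) (f : ι → ℚ) (h : ∀ i ∈ s, f i ∈ zLocal p) :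
    ∏ i ∈ s, f i ∈ zLocal p :=
  Subring.prod_mem (zLocalSubring p) h

theorem cast_prod_zLocal {ι : Type*} (s : Finset ι) (f : ι → ℚ) (h : ∀ i ∈ s, f i ∈ zLocal p) :
    ((∏ i ∈ s, f i : ℚ) : ZMod p) = ∏ i ∈ s, (f i : ZMod p) := by
  classical
  induction s using Finset.induction_on with
  | empty => simp
  | insert a s ha ih =>
    rw [Finset.prod_insert ha, Finset.prod_insert ha, cast_mul_zLocal (h _ (by simp))
      (prod_mem_zLocal _ _ fun i hi => h i (by simp [hi])), ih fun i hi => h i (by simp [hi])]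

/-- An element of `ℤ_(p)` with nonzero reduction is a unit. -/
theorem inv_mem_zLocal {x : ℚ} (hx : x ∈ zLocal p) (h0 : (x : ZMod p) ≠ 0) :
    x⁻¹ ∈ zLocal p := by
  have hx0 : x ≠ 0 := by rintro rfl; simp at h0
  have hd := den_cast_ne_zero hx
  rw [Rat.cast_def, div_ne_zero_iff] at h0
  have hn : ¬ p ∣ x.num.natAbs := by
    rw [← Int.natCast_dvd, ← ZMod.intCast_zmod_eq_zero_iff_dvd]
    exact h0.1
  intro h
  rw [Rat.den_inv_of_ne_zero hx0] at h
  exact hn h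

theorem cast_inv_zLocal {x : ℚ} (hx : x ∈ zLocal p) (h0 : (x : ZMod p) ≠ 0) :
    ((x⁻¹ : ℚ) : ZMod p) = (x : ZMod p)⁻¹ := by
  have hx0 : x ≠ 0 := by rintro rfl; simp at h0
  refine eq_inv_of_mul_eq_one_left ?_
  rw [← cast_mul_zLocal (inv_mem_zLocal hx h0) hx, inv_mul_cancel₀ hx0, Rat.cast_one]

/-- Multiplicative congruence: `x ∈ y (1 + p ℤ_(p))`. -/
def UnitCongr (p : ℕ) [Fact p.Prime] (x y : ℚ) : Prop :=
  ∃ u : ℚ, u ∈ zLocal p ∧ (u : ZMod p) = 1 ∧ x = y * u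

namespace UnitCongr

theorem refl (x : ℚ) : UnitCongr p x x :=
  ⟨1, (zLocalSubring p).one_mem, by simp, by simp⟩

theorem mul {x y x' y' : ℚ} (h : UnitCongr p x y) (h' : UnitCongr p x' y') :
    UnitCongr p (x * x') (y * y') := by
  obtain ⟨u, hu, hu1, rfl⟩ := h
  obtain ⟨v, hv, hv1, rfl⟩ := h'
  exact ⟨u * v, mul_mem_zLocal hu hv, by rw [cast_mul_zLocal hu hv, hu1, hv1, one_mul], by ring⟩

theorem inv {x y : ℚ} (h : UnitCongr p x y) : UnitCongr p x⁻¹ y⁻¹ := by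
  obtain ⟨u, hu, hu1, rfl⟩ := h
  exact ⟨u⁻¹, inv_mem_zLocal hu (by simp [hu1]),
    by rw [cast_inv_zLocal hu (by simp [hu1]), hu1, inv_one], by rw [mul_inv]⟩

theorem div {x y x' y' : ℚ} (h : UnitCongr p x y) (h' : UnitCongr p x' y') :
    UnitCongr p (x / x') (y / y') := by
  simpa only [div_eq_mul_inv] using h.mul h'.inv

theorem trans {x y z : ℚ} (h : UnitCongr p x y) (h' : UnitCongr p y z) : UnitCongr p x z := by
  obtain ⟨u, hu, hu1, rfl⟩ := h
  obtain ⟨v, hv, hv1, rfl⟩ := h'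
  exact ⟨v * u, mul_mem_zLocal hv hu, by rw [cast_mul_zLocal hv hu, hu1, hv1, one_mul], by ring⟩

theorem symm {x y : ℚ} (h : UnitCongr p x y) : UnitCongr p y x := by
  obtain ⟨u, hu, hu1, rfl⟩ := h
  have hu0 : u ≠ 0 := by rintro rfl; simp at hu1
  exact ⟨u⁻¹, inv_mem_zLocal hu (by simp [hu1]),
    by rw [cast_inv_zLocal hu (by simp [hu1]), hu1, inv_one], by field_simp⟩

theorem prod {ι : Type*} (s : Finset ι) {f g : ι → ℚ} (h : ∀ i ∈ s, UnitCongr p (f i) (g i)) :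
    UnitCongr p (∏ i ∈ s, f i) (∏ i ∈ s, g i) := by
  classical
  induction s using Finset.induction_on with
  | empty => exact refl _
  | insert a s ha ih =>
    rw [Finset.prod_insert ha, Finset.prod_insert ha]
    exact (h _ (by simp)).mul (ih fun i hi => h i (by simp [hi]))

theorem mem {x y : ℚ} (h : UnitCongr p x y) (hy : y ∈ zLocal p) : x ∈ zLocal p := by
  obtain ⟨u, hu, -, rfl⟩ := h
  exact mul_mem_zLocal hy hu

theorem cast_eq {x y : ℚ} (h : UnitCongr p x y) (hy : y ∈ zLocal p) :
    (x : ZMod p) = y := by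
  obtain ⟨u, hu, hu1, rfl⟩ := h
  rw [cast_mul_zLocal hy hu, hu1, mul_one]

theorem of_cast_eq {x y : ℚ} (hx : x ∈ zLocal p) (hy : y ∈ zLocal p)
    (h : (x : ZMod p) = y) (h0 : (y : ZMod p) ≠ 0) : UnitCongr p x y := by
  have hy0 : y ≠ 0 := by rintro rfl; simp at h0
  have hi := inv_mem_zLocal hy h0
  refine ⟨x * y⁻¹, mul_mem_zLocal hx hi, ?_, by field_simp⟩
  rw [cast_mul_zLocal hx hi, cast_inv_zLocal hy h0, h, mul_inv_cancel₀ h0]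

end UnitCongr

/-! ### Dwork's map on parameters -/

/-- A rational number of `(0, 1]` whose denominator divides `d`. -/
def IsParam (d : ℕ) (γ : ℚ) : Prop :=
  0 < γ ∧ γ ≤ 1 ∧ ∃ k : ℕ, d * γ = k

/-- The least `s ≥ 0` with `γ + s ≡ 0 mod p`. -/
def negResidue (p : ℕ) [Fact p.Prime] (γ : ℚ) : ℕ := (-(γ : ZMod p)).val

theorem negResidue_lt (γ : ℚ) : negResidue p γ < p := ZMod.val_lt _

theorem mul_dwork (γ : ℚ) : (p : ℚ) * dwork p γ = γ + negResidue p γ := by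
  have hp0 : (p : ℚ) ≠ 0 := by exact_mod_cast hp.out.ne_zero
  rw [dwork, negResidue]
  field_simp

theorem natCast_negResidue (γ : ℚ) : (negResidue p γ : ZMod p) = -(γ : ZMod p) := by
  simp [negResidue]

theorem cast_add_natCast {γ : ℚ} (hγ : γ ∈ zLocal p) (k : ℕ) :
    ((γ + k : ℚ) : ZMod p) = γ + k := by
  rw [cast_add_zLocal hγ (natCast_mem_zLocal k), Rat.cast_natCast]

theorem cast_add_ne_zero {γ : ℚ} {k : ℕ} (hk : k < p) (h : k ≠ negResidue p γ) :
    (γ : ZMod p) + k ≠ 0 := by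
  intro h0
  apply h
  rw [negResidue, ← eq_neg_of_add_eq_zero_right h0, ZMod.val_natCast_of_lt hk]

namespace IsParam

variable {d : ℕ} {γ γ' : ℚ}

theorem num_mem (hγ : IsParam d γ) (hd : 0 < d) {k : ℕ} (hk : d * γ = k) : 0 < k ∧ k ≤ d := by
  obtain ⟨h0, h1, -⟩ := hγ
  have hd' : (0 : ℚ) < d := by exact_mod_cast hd
  constructor
  · have : (0 : ℚ) < k := hk ▸ mul_pos hd' h0
    exact_mod_cast this
  · have : (k : ℚ) ≤ d := by nlinarith
    exact_mod_cast this

theorem mem_zLocal {p : ℕ} (hγ : IsParam d γ) (hd : 0 < d) (hdp : d < p) : γ ∈ zLocal p := by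
  obtain ⟨h0, h1, k, hk⟩ := hγ
  have hd' : (d : ℚ) ≠ 0 := by exact_mod_cast hd.ne'
  have h : γ = Rat.divInt k d := by
    rw [Rat.divInt_eq_div]; push_cast; field_simp; linarith
  intro hdvd
  have h2 : ((γ.den : ℕ) : ℤ) ∣ d := by rw [h]; exact Rat.den_dvd _ _
  have h3 : p ∣ d := hdvd.trans (by exact_mod_cast h2)
  exact absurd (Nat.le_of_dvd hd h3) (by omega)

theorem natCast_mul_cast (hγ : IsParam d γ) (hd : 0 < d) (hdp : d < p) {k : ℕ} (hk : d * γ = k) :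
    (d : ZMod p) * γ = k := by
  rw [← Rat.cast_natCast (α := ZMod p) k, ← hk,
    cast_mul_zLocal (natCast_mem_zLocal d) (hγ.mem_zLocal hd hdp), Rat.cast_natCast]

theorem cast_ne_zero (hγ : IsParam d γ) (hd : 0 < d) (hdp : d < p) : (γ : ZMod p) ≠ 0 := by
  obtain ⟨k, hk⟩ := hγ.2.2
  have h1 := hγ.natCast_mul_cast hd hdp hk
  have h2 := hγ.num_mem hd hk
  intro h0
  rw [h0, mul_zero, eq_comm, ZMod.natCast_eq_zero_iff] at h1
  exact absurd (Nat.le_of_dvd h2.1 h1) (by omega)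

theorem cast_injective (hγ : IsParam d γ) (hγ' : IsParam d γ') (hd : 0 < d) (hdp : d < p)
    (h : (γ : ZMod p) = γ') : γ = γ' := by
  obtain ⟨k, hk⟩ := hγ.2.2
  obtain ⟨k', hk'⟩ := hγ'.2.2
  have h1 := hγ.natCast_mul_cast hd hdp hk
  have h1' := hγ'.natCast_mul_cast hd hdp hk'
  have h2 := hγ.num_mem hd hk
  have h2' := hγ'.num_mem hd hk'
  rw [h, h1', ZMod.natCast_eq_natCast_iff'] at h1
  rw [Nat.mod_eq_of_lt (by omega), Nat.mod_eq_of_lt (by omega)] at h1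
  have hd' : (d : ℚ) ≠ 0 := by exact_mod_cast hd.ne'
  exact mul_left_cancel₀ hd' (by rw [hk, hk', h1])

theorem dwork (hγ : IsParam d γ) (hd : 0 < d) (hdp : d < p) : IsParam d (dwork p γ) := by
  have hp0 : (0 : ℚ) < p := by exact_mod_cast hp.out.pos
  have h := mul_dwork (p := p) γ
  have hs := negResidue_lt (p := p) γ
  have hs' : (negResidue p γ : ℚ) + 1 ≤ p := by exact_mod_cast hs
  have hmem : HypMod.dwork p γ ∈ zLocal p :=
    ((dwork_spec p (hγ.mem_zLocal hd hdp) _).2 rfl).1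
  refine ⟨pos_of_mul_pos_right (h ▸ add_pos_of_pos_of_nonneg hγ.1 (by positivity)) hp0.le, ?_, ?_⟩
  · have := hγ.2.1
    refine le_of_mul_le_mul_left ?_ hp0
    linarith
  · obtain ⟨k, hk⟩ := hγ.2.2
    -- `d δ = N / p` with `N = k + d s` divisible by `p`
    have hN : (p : ℚ) * (d * HypMod.dwork p γ) = ((k + d * negResidue p γ : ℕ) : ℚ) := by
      push_cast
      rw [← hk, mul_left_comm, h]; ring
    have hdvd : p ∣ k + d * negResidue p γ := by
      rw [← ZMod.natCast_eq_zero_iff]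
      push_cast
      rw [natCast_negResidue, ← hγ.natCast_mul_cast hd hdp hk]
      ring
    obtain ⟨c, hc⟩ := hdvd
    refine ⟨c, mul_left_cancel₀ hp0.ne' ?_⟩
    rw [hN, hc]; push_cast; ring

theorem dwork_injective (hγ : IsParam d γ) (hγ' : IsParam d γ')
    (h : HypMod.dwork p γ = HypMod.dwork p γ') : γ = γ' := by
  have h1 := mul_dwork (p := p) γ
  have h2 := mul_dwork (p := p) γ'
  rw [h, h2] at h1
  have h3 := hγ.1; have h4 := hγ.2.1; have h5 := hγ'.1; have h6 := hγ'.2.1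
  have h7 : (negResidue p γ : ℚ) < negResidue p γ' + 1 := by linarith
  have h8 : (negResidue p γ' : ℚ) < negResidue p γ + 1 := by linarith
  have h9 : negResidue p γ = negResidue p γ' := by
    have h7' : negResidue p γ < negResidue p γ' + 1 := by exact_mod_cast h7
    have h8' : negResidue p γ' < negResidue p γ + 1 := by exact_mod_cast h8
    omega
  rw [h9] at h1
  linarith

end IsParam

theorem negResidue_one : negResidue p 1 = p - 1 := by
  have h : (((p - 1 : ℕ) : ZMod p)) = -1 := by
    rw [Nat.cast_sub hp.out.one_lt.le]; simp
  rw [negResidue, Rat.cast_one, ← h, ZMod.val_natCast_of_lt]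
  have := hp.out.pos
  omega

theorem dwork_one : dwork p 1 = 1 := by
  have hp0 : (p : ℚ) ≠ 0 := by exact_mod_cast hp.out.ne_zero
  refine mul_left_cancel₀ hp0 ?_
  rw [mul_dwork, negResidue_one, Nat.cast_sub hp.out.one_lt.le]
  simp

theorem IsParam.iterate_dwork {d : ℕ} {γ : ℚ} (hγ : IsParam d γ) (hd : 0 < d) (hdp : d < p)
    (m : ℕ) : IsParam d ((HypMod.dwork p)^[m] γ) := by
  induction m with
  | zero => exact hγ
  | succ m ih => rw [Function.iterate_succ_apply']; exact ih.dwork hd hdp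

/-- Multiplication by `p` inverts `𝔇_p` on `(d⁻¹ℤ) / ℤ`, and a class in this group has only one
representative in `(0, 1]`. -/
theorem IsParam.iterate_dwork_eq_self {d l : ℕ} {γ : ℚ} (hγ : IsParam d γ) (hd : 0 < d)
    (hdp : d < p) (hl : (p : ZMod d) ^ l = 1) : (HypMod.dwork p)^[l] γ = γ := by
  obtain ⟨k, hk⟩ := hγ.2.2
  have key : ∀ m (k' : ℕ), d * (HypMod.dwork p)^[m] γ = k' → (p : ZMod d) ^ m * k' = k := by
    intro m
    induction m with
    | zero =>
      intro k' hk'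
      have : k' = k := by
        rw [Function.iterate_zero_apply, hk] at hk'
        exact_mod_cast hk'.symm
      simp [this]
    | succ m ih =>
      intro k' hk'
      obtain ⟨k₁, hk₁⟩ := (hγ.iterate_dwork (p := p) hd hdp m).2.2
      rw [← ih k₁ hk₁]
      rw [Function.iterate_succ_apply'] at hk'
      have h := mul_dwork (p := p) ((HypMod.dwork p)^[m] γ)
      have h1 : p * k' = k₁ + d * negResidue p ((HypMod.dwork p)^[m] γ) := by
        have : ((p * k' : ℕ) : ℚ) = ((k₁ + d * negResidue p ((HypMod.dwork p)^[m] γ) : ℕ) : ℚ) := by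
          push_cast
          rw [← hk', ← hk₁, mul_left_comm, h]; ring
        exact_mod_cast this
      have h2 := congrArg (Nat.cast : ℕ → ZMod d) h1
      push_cast at h2
      rw [pow_succ, mul_assoc, h2]
      simp
  have hi := hγ.iterate_dwork (p := p) hd hdp l
  obtain ⟨k', hk'⟩ := hi.2.2
  have h := key l k' hk'
  rw [hl, one_mul, ZMod.natCast_eq_natCast_iff] at h
  have b := hγ.num_mem hd hk
  have b' := hi.num_mem hd hk'
  have hkk : k' = k := by
    have h' : (k' - 1) + 1 ≡ (k - 1) + 1 [MOD d] := by
      rwa [Nat.sub_add_cancel b'.1, Nat.sub_add_cancel b.1]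
    have h'' := Nat.ModEq.add_right_cancel' 1 h'
    have := h''.eq_of_lt_of_lt (by omega) (by omega)
    omega
  have hd' : (d : ℚ) ≠ 0 := by exact_mod_cast hd.ne'
  exact mul_left_cancel₀ hd' (by rw [hk, hk', hkk])

/-! ### Congruences for hypergeometric coefficients -/

/-- The factor by which `(γ + pm)_a` differs from `(γ)_a`, up to `1 + p ℤ_(p)`: the only
factor `γ + k`, `k < a ≤ p`, divisible by `p` is the one with `k = negResidue p γ`. -/
def shiftFactor (p : ℕ) [Fact p.Prime] (a : ℕ) (γ : ℚ) (m : ℕ) : ℚ :=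
  if negResidue p γ < a then (dwork p γ + m) / dwork p γ else 1

theorem ascPochhammer_eval_pos {γ : ℚ} (hγ : 0 < γ) (i : ℕ) : 0 < (ascPochhammer ℚ i).eval γ :=
  ascPochhammer_pos i γ hγ

theorem ascPochhammer_shift {d : ℕ} {γ : ℚ} (hγ : IsParam d γ) (hd : 0 < d) (hdp : d < p)
    (m : ℕ) {a : ℕ} (ha : a ≤ p) :
    UnitCongr p ((ascPochhammer ℚ (a + p * m)).eval γ)
      ((ascPochhammer ℚ (p * m)).eval γ * (ascPochhammer ℚ a).eval γ * shiftFactor p a γ m) := by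
  induction a with
  | zero => simpa [shiftFactor] using UnitCongr.refl _
  | succ a ih =>
    have hmem := hγ.mem_zLocal hd hdp
    have h1 : a + 1 + p * m = (a + p * m) + 1 := by ring
    rw [h1, ascPochhammer_succ_eval, ascPochhammer_succ_eval]
    by_cases h : a = negResidue p γ
    · have hD : dwork p γ ≠ 0 := (hγ.dwork hd hdp).1.ne'
      have e : (γ + ((a + p * m : ℕ) : ℚ)) = (γ + a) * ((dwork p γ + m) / dwork p γ) := by
        push_cast
        rw [h, ← mul_dwork, ← add_assoc, ← mul_dwork]
        field_simp
      have := (ih (by omega)).mul (UnitCongr.refl (γ + ((a + p * m : ℕ) : ℚ)))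
      convert this using 1
      rw [e]
      simp only [shiftFactor, ← h, lt_irrefl, if_false, Nat.lt_succ_self, if_true]
      ring
    · have e : UnitCongr p (γ + ((a + p * m : ℕ) : ℚ)) (γ + a) := by
        refine UnitCongr.of_cast_eq (add_mem_zLocal hmem (natCast_mem_zLocal _))
          (add_mem_zLocal hmem (natCast_mem_zLocal _)) ?_ ?_
        · rw [cast_add_natCast hmem, cast_add_natCast hmem]
          simp
        · rw [cast_add_natCast hmem]
          exact cast_add_ne_zero (by omega) h
      have := (ih (by omega)).mul e
      convert this using 1
      have e2 : shiftFactor p (a + 1) γ m = shiftFactor p a γ m := by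
        have : negResidue p γ < a + 1 ↔ negResidue p γ < a := by omega
        simp only [shiftFactor, this]
      rw [e2]
      ring

/-- The product of the nonzero classes mod `p`, as a rational number. -/
def unitProd (p : ℕ) [Fact p.Prime] : ℚ :=
  ((∏ x : ZMod p, if x = 0 then 1 else x).val : ℚ)

theorem cast_unitProd : ((unitProd p : ℚ) : ZMod p) = ∏ x : ZMod p, if x = 0 then 1 else x := by
  rw [unitProd, Rat.cast_natCast, ZMod.natCast_zmod_val]

theorem cast_unitProd_ne_zero : ((unitProd p : ℚ) : ZMod p) ≠ 0 := by
  rw [cast_unitProd, Finset.prod_ne_zero_iff]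
  intro x _
  split_ifs with h
  · exact one_ne_zero
  · exact h

/-- `(γ)_p` has the single factor `p 𝔇_p(γ)` divisible by `p`; the others run through the nonzero
classes mod `p`, whatever `γ` is. -/
theorem ascPochhammer_prime {d : ℕ} {γ : ℚ} (hγ : IsParam d γ) (hd : 0 < d) (hdp : d < p) :
    UnitCongr p ((ascPochhammer ℚ p).eval γ) (p * dwork p γ * unitProd p) := by
  have hmem := hγ.mem_zLocal hd hdp
  have key : ∀ a, (ascPochhammer ℚ a).eval γ =
      (if negResidue p γ < a then p * dwork p γ else 1) *
        ∏ k ∈ Finset.range a, if k = negResidue p γ then 1 else γ + k := by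
    intro a
    induction a with
    | zero => simp
    | succ a ih =>
      rw [ascPochhammer_succ_eval, ih, Finset.prod_range_succ]
      by_cases h : a = negResidue p γ
      · simp only [← h, lt_irrefl, if_false, Nat.lt_succ_self, if_true]
        rw [mul_dwork, ← h]; ring
      · have : negResidue p γ < a + 1 ↔ negResidue p γ < a := by omega
        simp only [this, if_neg h]
        ring
  have hm : ∀ k ∈ Finset.range p,
      (if k = negResidue p γ then (1 : ℚ) else γ + k) ∈ zLocal p := by
    intro k _
    split_ifs
    · exact (zLocalSubring p).one_mem
    · exact add_mem_zLocal hmem (natCast_mem_zLocal _)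
  rw [key, if_pos (negResidue_lt γ)]
  refine (UnitCongr.refl _).mul (UnitCongr.of_cast_eq (prod_mem_zLocal _ _ hm)
    (natCast_mem_zLocal _) ?_ cast_unitProd_ne_zero)
  rw [cast_prod_zLocal _ _ hm, cast_unitProd, ← Equiv.prod_comp (Equiv.addLeft (γ : ZMod p))]
  refine Finset.prod_bij (fun k _ => (k : ZMod p)) (fun _ _ => Finset.mem_univ _) ?_ ?_ ?_
  · intro a ha b hb h
    rw [ZMod.natCast_eq_natCast_iff', Nat.mod_eq_of_lt (Finset.mem_range.1 ha),
      Nat.mod_eq_of_lt (Finset.mem_range.1 hb)] at h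
    exact h
  · intro b _
    exact ⟨b.val, Finset.mem_range.2 (ZMod.val_lt b), by simp⟩
  · intro k hk
    simp only [Equiv.coe_addLeft]
    by_cases h : k = negResidue p γ
    · simp [h, natCast_negResidue]
    · rw [if_neg h, cast_add_natCast hmem]
      exact (if_neg (cast_add_ne_zero (Finset.mem_range.1 hk) h)).symm

/-- Parameters `α, β` of `(0, 1]` with common denominator `d < p`, such that the numerator
parameters differ from the denominator parameters, `1` is among the latter, and the
hypergeometric coefficients are `p`-integral. -/
structure IsAdmissible (p : ℕ) [Fact p.Prime] (d : ℕ) {n : ℕ} (α β : Fin n → ℚ) : Prop where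
  d_pos : 0 < d
  d_lt : d < p
  num : ∀ k, IsParam d (α k)
  den : ∀ k, IsParam d (β k)
  ne : ∀ i j, α i ≠ β j
  one : ∃ j, β j = 1
  int : ∀ i, hypCoeff α β i ∈ zLocal p

/-- The factor by which `Q(a + pm)` differs from `Q(a) Q(pm)`, up to `1 + p ℤ_(p)`. -/
def coeffFactor (p : ℕ) [Fact p.Prime] {n : ℕ} (α β : Fin n → ℚ) (a m : ℕ) : ℚ :=
  ∏ k, shiftFactor p a (α k) m / shiftFactor p a (β k) m

theorem hypCoeff_eq {n : ℕ} (α β : Fin n → ℚ) (i : ℕ) :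
    hypCoeff α β i =
      ∏ k, (ascPochhammer ℚ i).eval (α k) / (ascPochhammer ℚ i).eval (β k) := by
  rw [hypCoeff, Finset.prod_div_distrib]

theorem hypCoeff_zero {n : ℕ} (α β : Fin n → ℚ) : hypCoeff α β 0 = 1 := by simp [hypCoeff]

theorem hypCoeff_succ {n : ℕ} (α β : Fin n → ℚ) (i : ℕ) :
    hypCoeff α β (i + 1) = hypCoeff α β i * ∏ k, (α k + i) / (β k + i) := by
  rw [hypCoeff_eq, hypCoeff_eq, ← Finset.prod_mul_distrib]
  refine Finset.prod_congr rfl fun k _ => ?_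
  rw [ascPochhammer_succ_eval, ascPochhammer_succ_eval, mul_div_mul_comm]

namespace IsAdmissible

variable {d n : ℕ} {α β : Fin n → ℚ}

theorem hypCoeff_pos (h : IsAdmissible p d α β) (i : ℕ) : 0 < hypCoeff α β i := by
  rw [hypCoeff_eq]
  exact Finset.prod_pos fun k _ =>
    div_pos (ascPochhammer_eval_pos (h.num k).1 i) (ascPochhammer_eval_pos (h.den k).1 i)

theorem hypCoeff_shift (h : IsAdmissible p d α β) (m : ℕ) {a : ℕ} (ha : a ≤ p) :
    UnitCongr p (hypCoeff α β (a + p * m))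
      (hypCoeff α β (p * m) * hypCoeff α β a * coeffFactor p α β a m) := by
  rw [hypCoeff_eq, hypCoeff_eq, hypCoeff_eq, coeffFactor, ← Finset.prod_mul_distrib,
    ← Finset.prod_mul_distrib]
  refine UnitCongr.prod _ fun k _ => ?_
  have := (ascPochhammer_shift (h.num k) h.d_pos h.d_lt m ha).div
    (ascPochhammer_shift (h.den k) h.d_pos h.d_lt m ha)
  convert this using 1
  rw [mul_div_mul_comm, mul_div_mul_comm]

/-- Dwork's congruence for the coefficients with index divisible by `p`. -/
theorem hypCoeff_mul_prime (h : IsAdmissible p d α β) (m : ℕ) :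
    UnitCongr p (hypCoeff α β (p * m))
      (hypCoeff (fun k => dwork p (α k)) (fun k => dwork p (β k)) m) := by
  have hp0 : (p : ℚ) ≠ 0 := by exact_mod_cast hp.out.ne_zero
  have hu : unitProd p ≠ 0 := fun h0 => cast_unitProd_ne_zero (p := p) (by simp [h0])
  induction m with
  | zero => simpa [hypCoeff_zero] using UnitCongr.refl _
  | succ m ih =>
    have e : p * (m + 1) = p + p * m := by ring
    rw [e, hypCoeff_succ]
    refine (h.hypCoeff_shift m le_rfl).trans ?_
    rw [mul_assoc]
    refine ih.mul ?_
    rw [hypCoeff_eq, coeffFactor, ← Finset.prod_mul_distrib]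
    refine UnitCongr.prod _ fun k _ => ?_
    have hDα : dwork p (α k) ≠ 0 := ((h.num k).dwork h.d_pos h.d_lt).1.ne'
    have hDβ : dwork p (β k) ≠ 0 := ((h.den k).dwork h.d_pos h.d_lt).1.ne'
    have hDβ' : dwork p (β k) + m ≠ 0 :=
      (add_pos_of_pos_of_nonneg ((h.den k).dwork h.d_pos h.d_lt).1 (Nat.cast_nonneg m)).ne'
    have := ((ascPochhammer_prime (h.num k) h.d_pos h.d_lt).div
      (ascPochhammer_prime (h.den k) h.d_pos h.d_lt)).mul
      (UnitCongr.refl (shiftFactor p p (α k) m / shiftFactor p p (β k) m))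
    convert this using 1
    simp only [shiftFactor, negResidue_lt, if_true]
    field_simp

theorem dwork (h : IsAdmissible p d α β) :
    IsAdmissible p d (fun k => dwork p (α k)) (fun k => dwork p (β k)) where
  d_pos := h.d_pos
  d_lt := h.d_lt
  num k := (h.num k).dwork h.d_pos h.d_lt
  den k := (h.den k).dwork h.d_pos h.d_lt
  ne i j hij := h.ne i j ((h.num i).dwork_injective (h.den j) hij)
  one := by
    obtain ⟨j, hj⟩ := h.one
    exact ⟨j, by rw [hj, dwork_one]⟩
  int i := (h.hypCoeff_mul_prime i).symm.mem (h.int _)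

theorem iterate_dwork (h : IsAdmissible p d α β) (m : ℕ) :
    IsAdmissible p d (fun k => (HypMod.dwork p)^[m] (α k))
      (fun k => (HypMod.dwork p)^[m] (β k)) := by
  induction m with
  | zero => exact h
  | succ m ih => simpa only [Function.iterate_succ_apply'] using ih.dwork

end IsAdmissible

/-! ### Sections of hypergeometric series mod `p` -/

/-- The reduction mod `p` of `Q_{α,β}(i)`, for `p`-integral coefficients. -/
def coeffMod (p : ℕ) [Fact p.Prime] {n : ℕ} (α β : Fin n → ℚ) (i : ℕ) : ZMod p :=
  (hypCoeff α β i : ZMod p)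

theorem natCast_add_mul_prime (r m : ℕ) : ((r + p * m : ℕ) : ZMod p) = r := by simp

theorem cast_add_add_mul_prime {γ : ℚ} (hγ : γ ∈ zLocal p) (r m : ℕ) :
    ((γ + (r + p * m : ℕ) : ℚ) : ZMod p) = γ + r := by
  rw [cast_add_natCast hγ, natCast_add_mul_prime]

section shiftFactor

variable {d : ℕ} {γ : ℚ}

theorem shiftFactor_mem (hγ : IsParam d γ) (hd : 0 < d) (hdp : d < p) (a m : ℕ) :
    shiftFactor p a γ m ∈ zLocal p := by
  have h := hγ.dwork (p := p) hd hdp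
  have hm := h.mem_zLocal hd hdp
  rw [shiftFactor]
  split_ifs
  · rw [div_eq_mul_inv]
    exact mul_mem_zLocal (add_mem_zLocal hm (natCast_mem_zLocal _))
      (inv_mem_zLocal hm (h.cast_ne_zero hd hdp))
  · exact (zLocalSubring p).one_mem

theorem cast_shiftFactor (hγ : IsParam d γ) (hd : 0 < d) (hdp : d < p) (a r m : ℕ) :
    (shiftFactor p a γ (r + p * m) : ZMod p) =
      if negResidue p γ < a then ((dwork p γ : ℚ) + r : ZMod p) / (dwork p γ : ℚ) else 1 := by
  have h := hγ.dwork (p := p) hd hdp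
  have hm := h.mem_zLocal hd hdp
  have h0 := h.cast_ne_zero hd hdp
  rw [shiftFactor]
  split_ifs
  · rw [div_eq_mul_inv, cast_mul_zLocal (add_mem_zLocal hm (natCast_mem_zLocal _))
      (inv_mem_zLocal hm h0), cast_inv_zLocal hm h0, cast_add_add_mul_prime hm, div_eq_mul_inv]
  · simp

end shiftFactor

namespace IsAdmissible

variable {d n : ℕ} {α β : Fin n → ℚ}

theorem coeffMod_shift (h : IsAdmissible p d α β) (m : ℕ) {a : ℕ} (ha : a ≤ p)
    (hI : hypCoeff (fun k => HypMod.dwork p (α k)) (fun k => HypMod.dwork p (β k)) m *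
      coeffFactor p α β a m ∈ zLocal p) :
    coeffMod p α β (a + p * m) = coeffMod p α β a *
      ((hypCoeff (fun k => HypMod.dwork p (α k)) (fun k => HypMod.dwork p (β k)) m *
        coeffFactor p α β a m : ℚ) : ZMod p) := by
  have h1 := (h.hypCoeff_shift m ha).trans (((h.hypCoeff_mul_prime m).mul
    (UnitCongr.refl (hypCoeff α β a))).mul (UnitCongr.refl (coeffFactor p α β a m)))
  have h2 : hypCoeff (fun k => HypMod.dwork p (α k)) (fun k => HypMod.dwork p (β k)) m *
      hypCoeff α β a * coeffFactor p α β a m = hypCoeff α β a *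
      (hypCoeff (fun k => HypMod.dwork p (α k)) (fun k => HypMod.dwork p (β k)) m *
        coeffFactor p α β a m) := by ring
  rw [h2] at h1
  rw [coeffMod, coeffMod, h1.cast_eq (mul_mem_zLocal (h.int a) hI),
    cast_mul_zLocal (h.int a) hI]

theorem cast_add_ne_cast_add (h : IsAdmissible p d α β) (i j : Fin n) (r : ℕ)
    (hj : (β j : ZMod p) + r = 0) : (α i : ZMod p) + r ≠ 0 := fun hi =>
  h.ne i j ((h.num i).cast_injective (h.den j) h.d_pos h.d_lt
    (add_right_cancel (hi.trans hj.symm)))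

/-- If a denominator of `coeffFactor` at indices congruent to `r` is divisible by `p`, it is
cancelled by passing to the next coefficient of the `𝔇_p`-transformed series, whose quotient by
the present one has that denominator as well. -/
theorem exists_section_coeffFactor (h : IsAdmissible p d α β) {a r : ℕ} (ha : a < p)
    (hr : r < p) :
    ∃ r' < p, ∃ c : ZMod p, ∀ m,
      hypCoeff (fun k => HypMod.dwork p (α k)) (fun k => HypMod.dwork p (β k)) (r + p * m) *
        coeffFactor p α β a (r + p * m) ∈ zLocal p ∧
      ((hypCoeff (fun k => HypMod.dwork p (α k)) (fun k => HypMod.dwork p (β k)) (r + p * m) *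
        coeffFactor p α β a (r + p * m) : ℚ) : ZMod p) =
        c * coeffMod p (fun k => HypMod.dwork p (α k)) (fun k => HypMod.dwork p (β k))
          (r' + p * m) := by
  have hD := h.dwork
  set α' : Fin n → ℚ := fun k => HypMod.dwork p (α k) with hα'
  set β' : Fin n → ℚ := fun k => HypMod.dwork p (β k) with hβ'
  have hαm : ∀ k, α' k ∈ zLocal p := fun k => (hD.num k).mem_zLocal h.d_pos h.d_lt
  have hβm : ∀ k, β' k ∈ zLocal p := fun k => (hD.den k).mem_zLocal h.d_pos h.d_lt
  -- it is enough to write the left-hand side as `Q'(r' + pm)` times an integral factor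
  -- whose class does not depend on `m`
  have red : ∀ (r' : ℕ) (τ : ℕ → ℚ) (c : ZMod p),
      (∀ m, τ m ∈ zLocal p ∧ (τ m : ZMod p) = c) →
      (∀ m, hypCoeff α' β' (r + p * m) * coeffFactor p α β a (r + p * m) =
        hypCoeff α' β' (r' + p * m) * τ m) → ∀ m,
      hypCoeff α' β' (r + p * m) * coeffFactor p α β a (r + p * m) ∈ zLocal p ∧
      ((hypCoeff α' β' (r + p * m) * coeffFactor p α β a (r + p * m) : ℚ) : ZMod p) =
        c * coeffMod p α' β' (r' + p * m) := by
    intro r' τ c hτ heq m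
    rw [heq]
    refine ⟨mul_mem_zLocal (hD.int _) (hτ m).1, ?_⟩
    rw [cast_mul_zLocal (hD.int _) (hτ m).1, (hτ m).2, mul_comm, coeffMod]
  by_cases hcase : ∃ j, negResidue p (β j) < a ∧ (β' j : ZMod p) + r = 0
  · obtain ⟨j, hja, hj⟩ := hcase
    -- `r = p - 1` would force `β j = 1`, whose factor divisible by `p` is only the last one
    have hr1 : r + 1 < p := by
      by_contra hcon
      have hrp : r = p - 1 := by omega
      have h1 : ((r : ℕ) : ZMod p) = -1 := by
        rw [hrp, Nat.cast_sub hp.out.one_lt.le]; simp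
      rw [h1, add_neg_eq_zero] at hj
      have h2 : β' j = HypMod.dwork p 1 := by
        rw [dwork_one]
        refine (hD.den j).cast_injective ?_ h.d_pos h.d_lt (by simpa using hj)
        exact ⟨one_pos, le_rfl, d, by simp⟩
      have h3 : β j = 1 :=
        (h.den j).dwork_injective (p := p) (γ' := 1) ⟨one_pos, le_rfl, d, by simp⟩ h2
      rw [h3, negResidue_one] at hja
      omega
    have hα0 : ∀ k m, ((α' k + (r + p * m : ℕ) : ℚ) : ZMod p) ≠ 0 := fun k m => by
      rw [cast_add_add_mul_prime (hαm k)]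
      exact hD.cast_add_ne_cast_add k j r hj
    refine ⟨r + 1, hr1, ∏ k, ((if negResidue p (α k) < a then
        ((α' k : ZMod p) + r : ZMod p) / (α' k : ZMod p) else 1) * ((α' k : ZMod p) + r)⁻¹ *
        (if negResidue p (β k) < a then (β' k : ZMod p) else (β' k : ZMod p) + r)), ?_⟩
    refine red (r + 1) (fun m => ∏ k, (shiftFactor p a (α k) (r + p * m) *
      (α' k + (r + p * m : ℕ))⁻¹ *
      (if negResidue p (β k) < a then β' k else β' k + (r + p * m : ℕ)))) _ ?_ ?_
    · intro m
      have m1 : ∀ k, shiftFactor p a (α k) (r + p * m) ∈ zLocal p := fun k =>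
        shiftFactor_mem (h.num k) h.d_pos h.d_lt _ _
      have m2 : ∀ k, (α' k + (r + p * m : ℕ))⁻¹ ∈ zLocal p := fun k =>
        inv_mem_zLocal (add_mem_zLocal (hαm k) (natCast_mem_zLocal _)) (hα0 k m)
      have m3 : ∀ k, (if negResidue p (β k) < a then β' k else β' k + (r + p * m : ℕ)) ∈
          zLocal p := fun k => by
        split_ifs
        · exact hβm k
        · exact add_mem_zLocal (hβm k) (natCast_mem_zLocal _)
      have m4 := fun k => mul_mem_zLocal (mul_mem_zLocal (m1 k) (m2 k)) (m3 k)
      refine ⟨prod_mem_zLocal _ _ fun k _ => m4 k, ?_⟩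
      rw [cast_prod_zLocal _ _ fun k _ => m4 k]
      refine Finset.prod_congr rfl fun k _ => ?_
      rw [cast_mul_zLocal (mul_mem_zLocal (m1 k) (m2 k)) (m3 k), cast_mul_zLocal (m1 k) (m2 k),
        cast_shiftFactor (h.num k) h.d_pos h.d_lt,
        cast_inv_zLocal (add_mem_zLocal (hαm k) (natCast_mem_zLocal _)) (hα0 k m),
        cast_add_add_mul_prime (hαm k)]
      congr 1
      split_ifs
      · rfl
      · exact cast_add_add_mul_prime (hβm k) _ _
    · intro m
      have e : r + 1 + p * m = (r + p * m) + 1 := by ring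
      rw [e, hypCoeff_succ, mul_assoc, coeffFactor, ← Finset.prod_mul_distrib]
      congr 1
      refine Finset.prod_congr rfl fun k _ => ?_
      have p1 : α' k + (r + p * m : ℕ) ≠ 0 :=
        (add_pos_of_pos_of_nonneg (hD.num k).1 (Nat.cast_nonneg _)).ne'
      have p2 : β' k + (r + p * m : ℕ) ≠ 0 :=
        (add_pos_of_pos_of_nonneg (hD.den k).1 (Nat.cast_nonneg _)).ne'
      have p3 : β' k ≠ 0 := (hD.den k).1.ne'
      have e2 : shiftFactor p a (β k) (r + p * m) =
          if negResidue p (β k) < a then (β' k + (r + p * m : ℕ)) / β' k else 1 := rfl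
      rw [e2]
      split_ifs
      · field_simp
      · field_simp
  · push Not at hcase
    have hβ0 : ∀ k m, (shiftFactor p a (β k) (r + p * m) : ZMod p) ≠ 0 := fun k m => by
      rw [cast_shiftFactor (h.den k) h.d_pos h.d_lt]
      split_ifs with hk
      · exact div_ne_zero (hcase k hk) ((hD.den k).cast_ne_zero h.d_pos h.d_lt)
      · exact one_ne_zero
    refine ⟨r, hr, _, red r (fun m => coeffFactor p α β a (r + p * m))
      (coeffFactor p α β a r : ZMod p) ?_ fun _ => rfl⟩
    have m1 : ∀ k m, shiftFactor p a (α k) m ∈ zLocal p := fun k m =>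
      shiftFactor_mem (h.num k) h.d_pos h.d_lt _ _
    have m2 : ∀ k m, shiftFactor p a (β k) m ∈ zLocal p := fun k m =>
      shiftFactor_mem (h.den k) h.d_pos h.d_lt _ _
    have m3 : ∀ k m, shiftFactor p a (α k) (r + p * m) / shiftFactor p a (β k) (r + p * m) ∈
        zLocal p := fun k m => by
      rw [div_eq_mul_inv]
      exact mul_mem_zLocal (m1 _ _) (inv_mem_zLocal (m2 _ _) (hβ0 k m))
    have key : ∀ m, ((coeffFactor p α β a (r + p * m) : ℚ) : ZMod p) =
        ∏ k, (if negResidue p (α k) < a then ((α' k : ZMod p) + r : ZMod p) / (α' k : ZMod p)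
          else 1) / (if negResidue p (β k) < a then
            ((β' k : ZMod p) + r : ZMod p) / (β' k : ZMod p) else 1) := fun m => by
      rw [coeffFactor, cast_prod_zLocal _ _ fun k _ => m3 k m]
      refine Finset.prod_congr rfl fun k _ => ?_
      rw [div_eq_mul_inv, cast_mul_zLocal (m1 _ _) (inv_mem_zLocal (m2 _ _) (hβ0 k m)),
        cast_inv_zLocal (m2 _ _) (hβ0 k m), cast_shiftFactor (h.num k) h.d_pos h.d_lt,
        cast_shiftFactor (h.den k) h.d_pos h.d_lt, ← div_eq_mul_inv]
    intro m
    refine ⟨prod_mem_zLocal _ _ fun k _ => m3 k m, ?_⟩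
    have := key 0
    rw [mul_zero, add_zero] at this
    rw [key, this]

/-- If `p` divides `Q(a)`, `a < p`, it divides all `Q(a + pm)`. -/
theorem coeffMod_add_mul_prime_eq_zero (h : IsAdmissible p d α β) {a : ℕ} (ha : a < p)
    (h0 : coeffMod p α β a = 0) (m : ℕ) : coeffMod p α β (a + p * m) = 0 := by
  obtain ⟨r', -, c, hc⟩ := h.exists_section_coeffFactor ha (Nat.mod_lt m hp.out.pos)
  have := (hc (m / p)).1
  rw [Nat.mod_add_div] at this
  rw [h.coeffMod_shift m ha.le this, h0, zero_mul]

/-- Between consecutive elements of `expSet`, the quotients of consecutive coefficients reduce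
mod `p` to functions of the index mod `p`. -/
theorem exists_expSet_section (h : IsAdmissible p d α β) {r : ℕ} (hr : r < p) :
    ∃ a ∈ expSet β p, ∃ c : ZMod p, ∀ m,
      coeffMod p α β (r + p * m) = c * coeffMod p α β (a + p * m) := by
  induction r with
  | zero =>
    obtain ⟨j, hj⟩ := h.one
    refine ⟨0, ?_, 1, by simp⟩
    simp only [expSet, Finset.mem_filter, Finset.mem_range]
    exact ⟨hp.out.pos, j, by simp [hj]⟩
  | succ r ih =>
    by_cases hE : r + 1 ∈ expSet β p
    · exact ⟨r + 1, hE, 1, by simp⟩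
    · obtain ⟨a, ha, c, hc⟩ := ih (by omega)
      have hβm : ∀ k, β k ∈ zLocal p := fun k => (h.den k).mem_zLocal h.d_pos h.d_lt
      have hαm : ∀ k, α k ∈ zLocal p := fun k => (h.num k).mem_zLocal h.d_pos h.d_lt
      have hβ0 : ∀ k m, ((β k + (r + p * m : ℕ) : ℚ) : ZMod p) ≠ 0 := fun k m h0 => by
        rw [cast_add_add_mul_prime (hβm k)] at h0
        refine hE ?_
        simp only [expSet, Finset.mem_filter, Finset.mem_range]
        refine ⟨hr, k, ?_⟩
        push_cast
        linear_combination h0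
      have m1 : ∀ k m, (α k + (r + p * m : ℕ)) / (β k + (r + p * m : ℕ)) ∈ zLocal p :=
        fun k m => by
          rw [div_eq_mul_inv]
          exact mul_mem_zLocal (add_mem_zLocal (hαm k) (natCast_mem_zLocal _))
            (inv_mem_zLocal (add_mem_zLocal (hβm k) (natCast_mem_zLocal _)) (hβ0 k m))
      refine ⟨a, ha, (∏ k, ((α k : ZMod p) + r) / ((β k : ZMod p) + r)) * c, fun m => ?_⟩
      have e : r + 1 + p * m = (r + p * m) + 1 := by ring
      rw [mul_assoc, ← hc, e, coeffMod, hypCoeff_succ, cast_mul_zLocal (h.int _)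
        (prod_mem_zLocal _ _ fun k _ => m1 k m), cast_prod_zLocal _ _ fun k _ => m1 k m,
        mul_comm, coeffMod]
      congr 1
      refine Finset.prod_congr rfl fun k _ => ?_
      rw [div_eq_mul_inv, cast_mul_zLocal (add_mem_zLocal (hαm k) (natCast_mem_zLocal _))
            (inv_mem_zLocal (add_mem_zLocal (hβm k) (natCast_mem_zLocal _)) (hβ0 k m)),
        cast_inv_zLocal (add_mem_zLocal (hβm k) (natCast_mem_zLocal _)) (hβ0 k m),
        cast_add_add_mul_prime (hαm k), cast_add_add_mul_prime (hβm k), div_eq_mul_inv]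

theorem coeffMod_ne_zero_iff (h : IsAdmissible p d α β) (i : ℕ) :
    coeffMod p α β i ≠ 0 ↔ hypCoeff α β i ≠ 0 ∧ padicValRat p (hypCoeff α β i) = 0 := by
  have hpos := h.hypCoeff_pos i
  have hden : padicValNat p (hypCoeff α β i).den = 0 :=
    padicValNat.eq_zero_of_not_dvd (h.int i)
  have hd := den_cast_ne_zero (h.int i)
  have hnum : (hypCoeff α β i).num ≠ 0 := Rat.num_ne_zero.2 hpos.ne'
  rw [coeffMod, padicValRat, hden, Rat.cast_def, div_ne_zero_iff, and_iff_left hd,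
    and_iff_right hpos.ne', Ne, ZMod.intCast_zmod_eq_zero_iff_dvd]
  simp only [Nat.cast_zero, sub_zero, Nat.cast_eq_zero, padicValInt.eq_zero_iff, hnum,
    hp.out.ne_one, false_or]

theorem mem_unitExpSet (h : IsAdmissible p d α β) {a : ℕ} :
    a ∈ unitExpSet α β p ↔ a ∈ expSet β p ∧ coeffMod p α β a ≠ 0 := by
  rw [unitExpSet, Finset.mem_filter, h.coeffMod_ne_zero_iff]

theorem zero_mem_unitExpSet (h : IsAdmissible p d α β) : 0 ∈ unitExpSet α β p := by
  rw [h.mem_unitExpSet]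
  constructor
  · obtain ⟨j, hj⟩ := h.one
    simp only [expSet, Finset.mem_filter, Finset.mem_range]
    exact ⟨hp.out.pos, j, by simp [hj]⟩
  · simp [coeffMod, hypCoeff_zero]

theorem lt_of_mem_unitExpSet {α β : Fin n → ℚ} {a : ℕ} (ha : a ∈ unitExpSet α β p) : a < p := by
  rw [unitExpSet, Finset.mem_filter, expSet, Finset.mem_filter, Finset.mem_range] at ha
  exact ha.1.1

theorem exists_unitExpSet_section (h : IsAdmissible p d α β) {r : ℕ} (hr : r < p) :
    ∃ a ∈ unitExpSet α β p, ∃ c : ZMod p, ∀ m,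
      coeffMod p α β (r + p * m) = c * coeffMod p α β (a + p * m) := by
  obtain ⟨a, ha, c, hc⟩ := h.exists_expSet_section hr
  by_cases h0 : coeffMod p α β a = 0
  · have hap : a < p := by
      rw [expSet, Finset.mem_filter, Finset.mem_range] at ha
      exact ha.1
    refine ⟨0, h.zero_mem_unitExpSet, 0, fun m => ?_⟩
    rw [hc, h.coeffMod_add_mul_prime_eq_zero hap h0, mul_zero, zero_mul]
  · exact ⟨a, h.mem_unitExpSet.2 ⟨ha, h0⟩, c, hc⟩

/-- One step of the Frobenius action: the sections mod `p` of the series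
`∑ Q_{α,β}(a + pm) zᵐ` are multiples of the analogous series for `𝔇_p(α), 𝔇_p(β)`. -/
theorem exists_section (h : IsAdmissible p d α β) {a r : ℕ} (ha : a < p) (hr : r < p) :
    ∃ a' ∈ unitExpSet (fun k => HypMod.dwork p (α k)) (fun k => HypMod.dwork p (β k)) p,
      ∃ c : ZMod p, ∀ m, coeffMod p α β (a + p * (r + p * m)) =
        c * coeffMod p (fun k => HypMod.dwork p (α k)) (fun k => HypMod.dwork p (β k))
          (a' + p * m) := by
  obtain ⟨r', hr', c, hc⟩ := h.exists_section_coeffFactor ha hr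
  obtain ⟨a', ha', c', hc'⟩ := h.dwork.exists_unitExpSet_section hr'
  refine ⟨a', ha', coeffMod p α β a * c * c', fun m => ?_⟩
  rw [h.coeffMod_shift _ ha.le (hc m).1, (hc m).2, hc']
  ring

/-- The sections of order `pᵏ`, by iteration of `exists_section`. -/
theorem exists_iterate_section (h : IsAdmissible p d α β) (k : ℕ) {a r : ℕ}
    (ha : a ∈ unitExpSet α β p) (hr : r < p ^ k) :
    ∃ a' ∈ unitExpSet (fun i => (HypMod.dwork p)^[k] (α i))
        (fun i => (HypMod.dwork p)^[k] (β i)) p,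
      ∃ c : ZMod p, ∀ m, coeffMod p α β (a + p * (r + p ^ k * m)) =
        c * coeffMod p (fun i => (HypMod.dwork p)^[k] (α i))
          (fun i => (HypMod.dwork p)^[k] (β i)) (a' + p * m) := by
  induction k generalizing r with
  | zero => exact ⟨a, ha, 1, fun m => by simp [show r = 0 by simpa using hr]⟩
  | succ k ih =>
    obtain ⟨a₁, ha₁, c₁, h₁⟩ := ih (Nat.mod_lt r (pow_pos hp.out.pos k))
    -- `r = (r mod pᵏ) + pᵏ r'` with `r' < p` the index of the last section
    obtain ⟨a₂, ha₂, c₂, h₂⟩ := (h.iterate_dwork k).exists_section (lt_of_mem_unitExpSet ha₁)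
      (r := r / p ^ k) (Nat.div_lt_of_lt_mul (by rwa [← pow_succ]))
    simp only [← Function.iterate_succ_apply'] at ha₂ h₂
    refine ⟨a₂, ha₂, c₁ * c₂, fun m => ?_⟩
    rw [mul_assoc, ← h₂, ← h₁]
    congr 3
    conv_lhs => rw [← Nat.mod_add_div r (p ^ k)]
    ring

end IsAdmissible

end

/-! ### Frobenius relations from sections -/

section Sections

variable {p : ℕ} [hp : Fact p.Prime]

theorem powerSeries_pow_prime (g : PowerSeries (ZMod p)) :
    g ^ p = PowerSeries.expand p hp.out.ne_zero g := by
  have h := MvPowerSeries.map_frobenius_expand p hp.out.ne_zero (f := g)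
  rw [ZMod.frobenius_zmod] at h
  have h2 : (MvPowerSeries.map (RingHom.id (ZMod p))) =
      RingHom.id (MvPowerSeries Unit (ZMod p)) := MvPowerSeries.map_id
  rw [h2] at h
  exact h.symm

theorem powerSeries_pow_prime_pow (g : PowerSeries (ZMod p)) (k : ℕ) :
    g ^ p ^ k = PowerSeries.expand (p ^ k) (pow_ne_zero k hp.out.ne_zero) g := by
  induction k with
  | zero => simp
  | succ k ih =>
    have e : g ^ p ^ (k + 1) = (g ^ p ^ k) ^ p := by rw [pow_succ, pow_mul]
    rw [e, ih, powerSeries_pow_prime, ← PowerSeries.expand_mul]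
    simp only [pow_succ, mul_comm]

/-- The series `∑ g_{r + Qm} zᵐ`. -/
def powerSeriesSection {R : Type*} [Semiring R] (Q r : ℕ) (g : PowerSeries R) : PowerSeries R :=
  PowerSeries.mk fun m => PowerSeries.coeff (r + Q * m) g

theorem coeff_mul_expand {R : Type*} [CommRing R] {Q r : ℕ} (hr : r < Q) (g h : PowerSeries R)
    (m : ℕ) : PowerSeries.coeff (r + Q * m) (g * PowerSeries.expand Q (by omega) h) =
      PowerSeries.coeff m (powerSeriesSection Q r g * h) := by
  have hQ : 0 < Q := by omega
  rw [PowerSeries.coeff_mul, PowerSeries.coeff_mul]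
  symm
  refine Finset.sum_of_injOn (fun x : ℕ × ℕ => (r + Q * x.1, Q * x.2)) ?_ ?_ ?_ ?_
  · rintro ⟨a, b⟩ - ⟨a', b'⟩ - h
    simp only [Prod.mk.injEq] at h
    ext
    · exact Nat.eq_of_mul_eq_mul_left hQ (by simpa using h.1)
    · exact Nat.eq_of_mul_eq_mul_left hQ h.2
  · rintro ⟨a, b⟩ hab
    simp only [Finset.mem_coe, Finset.HasAntidiagonal.mem_antidiagonal] at hab ⊢
    rw [← hab]; ring
  · rintro ⟨a, b⟩ hab hnot
    rw [Finset.HasAntidiagonal.mem_antidiagonal] at hab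
    simp only at hab
    rw [PowerSeries.coeff_expand, if_neg, mul_zero]
    rintro ⟨b', rfl⟩
    refine hnot ?_
    have hb : b' ≤ m := by
      by_contra hcon
      have : Q * (m + 1) ≤ Q * b' := Nat.mul_le_mul_left _ (by omega)
      rw [mul_add, mul_one] at this
      omega
    refine ⟨(m - b', b'), by simp [hb], ?_⟩
    simp only [Prod.mk.injEq, and_true]
    rw [Nat.mul_sub]
    have := Nat.mul_le_mul_left Q hb
    omega
  · rintro ⟨a, b⟩ -
    simp [powerSeriesSection]

theorem coeff_mul_pow {k r : ℕ} (hr : r < p ^ k) (g h : PowerSeries (ZMod p)) (m : ℕ) :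
    PowerSeries.coeff (r + p ^ k * m) (g * h ^ p ^ k) =
      PowerSeries.coeff m (powerSeriesSection (p ^ k) r g * h) := by
  rw [powerSeries_pow_prime_pow, coeff_mul_expand hr]

theorem exists_polynomial_section {R : Type*} [Semiring R] {H : ℕ} (Q r : ℕ) (hQ : 0 < Q)
    (c : R[X]) (hc : c.natDegree < H) :
    ∃ e : R[X], e.natDegree < H ∧
      (e : PowerSeries R) = powerSeriesSection Q r (c : PowerSeries R) := by
  refine ⟨∑ m ∈ Finset.range H, monomial m (c.coeff (r + Q * m)), ?_, ?_⟩
  · refine (natDegree_sum_le_of_forall_le (n := H - 1) _ _ fun m hm => ?_).trans_lt (by omega)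
    exact (natDegree_monomial_le _).trans (by have := Finset.mem_range.1 hm; omega)
  · ext m
    rw [Polynomial.coeff_coe, finsetSum_coeff]
    simp only [coeff_monomial, Finset.sum_ite_eq', Finset.mem_range, powerSeriesSection,
      PowerSeries.coeff_mk, Polynomial.coeff_coe]
    split_ifs with h
    · rfl
    · rw [coeff_eq_zero_of_natDegree_lt]
      have := Nat.le_mul_of_pos_left m hQ
      omega

/-- A series all of whose sections of order `pᵏ` are multiples of members of a finite family is a
polynomial combination of the `pᵏ`-th powers of the family. -/
theorem eq_sum_mul_pow_of_sections (T : Finset ℕ) (f : PowerSeries (ZMod p))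
    (h : ℕ → PowerSeries (ZMod p)) (k : ℕ)
    (hs : ∀ r < p ^ k, ∃ a ∈ T, ∃ c : ZMod p, ∀ m,
      PowerSeries.coeff (r + p ^ k * m) f = c * PowerSeries.coeff m (h a)) :
    ∃ W : ℕ → (ZMod p)[X], (∀ a, (W a).natDegree < p ^ k) ∧
      f = ∑ a ∈ T, (W a : PowerSeries (ZMod p)) * h a ^ p ^ k := by
  choose! σ hσ c hc using hs
  have hpk : 0 < p ^ k := pow_pos hp.out.pos k
  refine ⟨fun a => ∑ r ∈ Finset.range (p ^ k), if σ r = a then monomial r (c r) else 0, ?_, ?_⟩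
  · intro a
    refine (natDegree_sum_le_of_forall_le (n := p ^ k - 1) _ _ fun r hr => ?_).trans_lt (by omega)
    have := Finset.mem_range.1 hr
    split_ifs
    · exact (natDegree_monomial_le _).trans (by omega)
    · simp
  · have e : ∑ a ∈ T, ((∑ r ∈ Finset.range (p ^ k), if σ r = a then monomial r (c r) else 0 :
          (ZMod p)[X]) : PowerSeries (ZMod p)) * h a ^ p ^ k =
        ∑ r ∈ Finset.range (p ^ k), PowerSeries.monomial r (c r) * h (σ r) ^ p ^ k := by
      have e1 : ∀ a, ((∑ r ∈ Finset.range (p ^ k), if σ r = a then monomial r (c r) else 0 :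
          (ZMod p)[X]) : PowerSeries (ZMod p)) =
          ∑ r ∈ Finset.range (p ^ k), if σ r = a then PowerSeries.monomial r (c r) else 0 := by
        intro a
        rw [← Polynomial.coeToPowerSeries.ringHom_apply, map_sum]
        refine Finset.sum_congr rfl fun r _ => ?_
        rw [Polynomial.coeToPowerSeries.ringHom_apply]
        split_ifs
        · exact Polynomial.coe_monomial r (c r)
        · exact Polynomial.coe_zero
      simp only [e1, Finset.sum_mul]
      rw [Finset.sum_comm]
      refine Finset.sum_congr rfl fun r hr => ?_
      simp only [ite_mul, zero_mul]
      rw [Finset.sum_ite_eq, if_pos (hσ r (Finset.mem_range.1 hr))]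
    rw [e]
    ext n
    obtain ⟨r₀, m, hr₀, rfl⟩ : ∃ r₀ m, r₀ < p ^ k ∧ r₀ + p ^ k * m = n :=
      ⟨n % p ^ k, n / p ^ k, Nat.mod_lt _ hpk, Nat.mod_add_div _ _⟩
    rw [map_sum, Finset.sum_eq_single r₀]
    · rw [coeff_mul_pow hr₀, hc r₀ hr₀]
      have : powerSeriesSection (p ^ k) r₀ (PowerSeries.monomial r₀ (c r₀)) =
          PowerSeries.C (c r₀) := by
        ext i
        simp [powerSeriesSection, PowerSeries.coeff_monomial, PowerSeries.coeff_C, hp.out.ne_zero]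
      rw [this, PowerSeries.coeff_C_mul]
    · intro r hr hne
      rw [coeff_mul_pow hr₀]
      have : powerSeriesSection (p ^ k) r₀ (PowerSeries.monomial r (c r)) = 0 := by
        ext i
        rw [powerSeriesSection, PowerSeries.coeff_mk, PowerSeries.coeff_monomial, if_neg, map_zero]
        intro h
        have h2 := congrArg (· % p ^ k) h
        simp only [Nat.add_mul_mod_self_left, Nat.mod_eq_of_lt hr₀,
          Nat.mod_eq_of_lt (Finset.mem_range.1 hr)] at h2
        exact hne h2.symm
      rw [this, zero_mul, map_zero]
    · intro h
      exact absurd (Finset.mem_range.2 hr₀) h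

/-- A nontrivial relation between the powers `f ^ qⁱ` yields one whose coefficient of `f` is
nonzero: apply a section that does not kill the lowest coefficient. -/
theorem exists_relation_coeff_zero_ne_zero {l N H : ℕ} (f : PowerSeries (ZMod p))
    (c : ℕ → (ZMod p)[X]) (hdeg : ∀ i, (c i).natDegree < H) (hne : ∃ i ≤ N, c i ≠ 0)
    (hrel : ∑ i ∈ Finset.range (N + 1), (c i : PowerSeries (ZMod p)) * f ^ p ^ (i * l) = 0) :
    ∃ e : ℕ → (ZMod p)[X], e 0 ≠ 0 ∧ (∀ i, (e i).natDegree < H) ∧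
      ∑ i ∈ Finset.range (N + 1), (e i : PowerSeries (ZMod p)) * f ^ p ^ (i * l) = 0 := by
  classical
  obtain ⟨hkN, hk0⟩ := Nat.find_spec hne
  have hkmin : ∀ i < Nat.find hne, c i = 0 := fun i hi => by
    by_contra hci
    exact Nat.find_min hne hi ⟨by omega, hci⟩
  set k := Nat.find hne
  have hQ : 0 < p ^ (k * l) := pow_pos hp.out.pos _
  obtain ⟨n₀, hn₀⟩ : ∃ n₀, (c k).coeff n₀ ≠ 0 := by
    by_contra! hcon
    exact hk0 (Polynomial.ext (by simpa using hcon))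
  have hr : n₀ % p ^ (k * l) < p ^ (k * l) := Nat.mod_lt _ hQ
  have hsec := fun i => exists_polynomial_section (p ^ (k * l)) (n₀ % p ^ (k * l)) hQ (c i) (hdeg i)
  choose s hsdeg hs using hsec
  have hH : 0 < H := (Nat.zero_le _).trans_lt (hdeg 0)
  refine ⟨fun i => if i + k ≤ N then s (i + k) else 0, ?_, ?_, ?_⟩
  · simp only [zero_add, if_pos hkN]
    intro h0
    have h1 := congrArg (PowerSeries.coeff (n₀ / p ^ (k * l))) (hs k)
    rw [h0, powerSeriesSection, PowerSeries.coeff_mk, Nat.mod_add_div, Polynomial.coeff_coe,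
      Polynomial.coeff_coe] at h1
    exact hn₀ (by simpa using h1.symm)
  · intro i
    dsimp only
    split_ifs
    · exact hsdeg _
    · simpa using hH
  · ext m
    have h1 := congrArg (PowerSeries.coeff (n₀ % p ^ (k * l) + p ^ (k * l) * m)) hrel
    rw [map_sum, map_zero] at h1
    rw [map_sum, map_zero, ← h1]
    have hsplit : N + 1 = k + (N + 1 - k) := by omega
    have e1 : ∑ i ∈ Finset.range (N + 1), PowerSeries.coeff (n₀ % p ^ (k * l) + p ^ (k * l) * m)
          ((c i : PowerSeries (ZMod p)) * f ^ p ^ (i * l)) =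
        ∑ i ∈ Finset.range (N + 1 - k), PowerSeries.coeff (n₀ % p ^ (k * l) + p ^ (k * l) * m)
          ((c (k + i) : PowerSeries (ZMod p)) * f ^ p ^ ((k + i) * l)) := by
      conv_lhs => rw [hsplit, Finset.sum_range_add]
      rw [Finset.sum_eq_zero, zero_add]
      intro i hi
      rw [hkmin i (Finset.mem_range.1 hi)]
      simp
    have hsplit2 : N + 1 = (N + 1 - k) + k := by omega
    rw [e1]
    conv_lhs => rw [hsplit2, Finset.sum_range_add]
    rw [Finset.sum_eq_zero (s := Finset.range k), add_zero]
    · refine Finset.sum_congr rfl fun i hi => ?_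
      have hi' := Finset.mem_range.1 hi
      have e2 : f ^ p ^ ((k + i) * l) = (f ^ p ^ (i * l)) ^ p ^ (k * l) := by
        rw [← pow_mul, ← pow_add]; congr 2; ring
      dsimp only
      rw [e2, coeff_mul_pow hr, if_pos (by omega), hs, add_comm i k]
    · intro i _
      dsimp only
      rw [if_neg (by omega)]
      simp

end Sections

/-- Dimension count: `N + 1` combinations of `N` elements with polynomial coefficients of degree
less than `D` satisfy a linear relation with coefficients of degree less than `N D`. -/
theorem exists_relation_of_card {K ι A : Type*} [Field K] [Fintype ι] [CommRing A] [Algebra K[X] A]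
    {N D : ℕ} (hN : 0 < N) (hcard : Fintype.card ι = N) (u : ι → A)
    (w : Fin (N + 1) → ι → K[X]) (hw : ∀ i a, (w i a).natDegree < D) :
    ∃ c : Fin (N + 1) → K[X], c ≠ 0 ∧ (∀ i, (c i).natDegree < N * D) ∧
      ∑ i, algebraMap K[X] A (c i) * ∑ a, algebraMap K[X] A (w i a) * u a = 0 := by
  have hι : Nonempty ι := Fintype.card_pos_iff.1 (by omega)
  have hD : 0 < D := (Nat.zero_le _).trans_lt (hw 0 hι.some)
  have hB : 0 < N * D := Nat.mul_pos hN hD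
  -- coefficients of degree `≥ N D + D - 1` of the combinations vanish automatically, which
  -- leaves `N (N D + D - 1)` equations for `(N + 1) N D` unknowns
  let φ : (Fin (N + 1) → degreeLT K (N * D)) →ₗ[K] (ι → Fin (N * D + D - 1) → K) :=
    { toFun := fun c a j => (∑ i, (c i : K[X]) * w i a).coeff j
      map_add' := fun x y => by
        ext a j
        simp [add_mul, Finset.sum_add_distrib]
      map_smul' := fun t x => by
        ext a j
        simp [Finset.mul_sum] }
  have hrank : Module.finrank K (ι → Fin (N * D + D - 1) → K) <
      Module.finrank K (Fin (N + 1) → degreeLT K (N * D)) := by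
    have h1 : Module.finrank K (degreeLT K (N * D)) = N * D := by
      rw [(degreeLTEquiv K (N * D)).finrank_eq, Module.finrank_fin_fun]
    have : Module.Finite K (degreeLT K (N * D)) := Module.Finite.equiv (degreeLTEquiv K (N * D)).symm
    have h2 : Module.finrank K (Fin (N + 1) → degreeLT K (N * D)) = (N + 1) * (N * D) := by
      rw [Module.finrank_pi_fintype]
      simp only [h1, Finset.sum_const, Finset.card_univ, Fintype.card_fin, smul_eq_mul]
    have h3 : Module.finrank K (ι → Fin (N * D + D - 1) → K) = N * (N * D + D - 1) := by
      rw [Module.finrank_pi_fintype]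
      simp only [Module.finrank_fin_fun, Finset.sum_const, Finset.card_univ, hcard, smul_eq_mul]
    rw [h2, h3]
    obtain ⟨D', rfl⟩ : ∃ D', D = D' + 1 := ⟨D - 1, by omega⟩
    have : N * (D' + 1) + (D' + 1) - 1 = N * (D' + 1) + D' := by omega
    rw [this]
    nlinarith
  have : Module.Finite K (degreeLT K (N * D)) := Module.Finite.equiv (degreeLTEquiv K (N * D)).symm
  obtain ⟨c, hcker, hc0⟩ := Submodule.exists_mem_ne_zero_of_ne_bot (φ.ker_ne_bot_of_finrank_lt hrank)
  have hdeg : ∀ i, (c i : K[X]).natDegree < N * D := fun i => by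
    rcases eq_or_ne (c i : K[X]) 0 with h | h
    · rw [h]; simpa using hB
    · exact (natDegree_lt_iff_degree_lt h).2 (mem_degreeLT.1 (c i).2)
  have hzero : ∀ a, ∑ i, (c i : K[X]) * w i a = 0 := fun a => by
    ext j
    rcases lt_or_ge j (N * D + D - 1) with hj | hj
    · have := congrFun (congrFun (LinearMap.mem_ker.1 hcker) a) ⟨j, hj⟩
      simpa [φ] using this
    · rw [finsetSum_coeff, coeff_zero]
      refine Finset.sum_eq_zero fun i _ => coeff_eq_zero_of_natDegree_lt ?_
      have h1 := natDegree_mul_le (p := (c i : K[X])) (q := w i a)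
      have h2 := hdeg i
      have h3 := hw i a
      omega
  refine ⟨fun i => c i, ?_, hdeg, ?_⟩
  · intro h
    exact hc0 (funext fun i => Subtype.ext (congrFun h i))
  · simp only [Finset.mul_sum]
    rw [Finset.sum_comm]
    refine Finset.sum_eq_zero fun a _ => ?_
    simp only [← mul_assoc, ← map_mul]
    rw [← Finset.sum_mul, ← map_sum, hzero, map_zero, zero_mul]

/-- A series in the span of the `q^k`-th powers, `k ≤ N`, of `N` fixed series satisfies an
algebraic equation that is additive in the powers `f ^ qⁱ`. -/
theorem exists_frobenius_relation {p : ℕ} [hp : Fact p.Prime] {l : ℕ} (T : Finset ℕ)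
    (hT : T.Nonempty) (f : PowerSeries (ZMod p)) (h : ℕ → PowerSeries (ZMod p))
    (hf : ∀ k, ∃ W : ℕ → (ZMod p)[X], (∀ a, (W a).natDegree < p ^ (k * l)) ∧
      f = ∑ a ∈ T, (W a : PowerSeries (ZMod p)) * h a ^ p ^ (k * l)) :
    ∃ e : ℕ → (ZMod p)[X], e 0 ≠ 0 ∧ (∀ i, (e i).natDegree < T.card * p ^ (T.card * l)) ∧
      ∑ i ∈ Finset.range (T.card + 1),
        (e i : PowerSeries (ZMod p)) * f ^ p ^ (i * l) = 0 := by
  have : CharP (PowerSeries (ZMod p)) p :=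
    charP_of_injective_ringHom (PowerSeries.C_injective (R := ZMod p)) p
  choose W hWdeg hW using hf
  set N := T.card with hNdef
  have hN : 0 < N := Finset.card_pos.2 hT
  -- express every `f ^ qⁱ`, `i ≤ N`, through the `q ^ N`-th powers of the family
  have hpow : ∀ i : Fin (N + 1), f ^ p ^ ((i : ℕ) * l) =
      ∑ a : T, algebraMap (ZMod p)[X] (PowerSeries (ZMod p))
        ((W (N - i) a) ^ p ^ ((i : ℕ) * l)) * h a ^ p ^ (N * l) := by
    intro i
    conv_lhs => rw [hW (N - i)]
    rw [sum_pow_char_pow, ← Finset.sum_coe_sort T]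
    refine Finset.sum_congr rfl fun a _ => ?_
    rw [mul_pow, ← pow_mul, ← pow_add, ← add_mul, Nat.sub_add_cancel (by omega), map_pow]
    rfl
  have hdeg : ∀ (i : Fin (N + 1)) (a : T),
      ((W (N - i) a) ^ p ^ ((i : ℕ) * l)).natDegree < p ^ (N * l) := by
    intro i a
    refine natDegree_pow_le.trans_lt ?_
    have e : p ^ (N * l) = p ^ ((i : ℕ) * l) * p ^ ((N - i) * l) := by
      rw [← pow_add, ← add_mul, Nat.add_sub_cancel' (by omega)]
    rw [e]
    exact Nat.mul_lt_mul_of_pos_left (hWdeg _ _) (pow_pos hp.out.pos _)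
  obtain ⟨c, hc0, hcdeg, hc⟩ := exists_relation_of_card (A := PowerSeries (ZMod p)) hN
    (by rw [Fintype.card_coe]) (fun a : T => h a ^ p ^ (N * l)) _ hdeg
  simp only [← hpow] at hc
  obtain ⟨i₀, hi₀⟩ := Function.ne_iff.1 hc0
  have hH : 0 < N * p ^ (N * l) := Nat.mul_pos hN (pow_pos hp.out.pos _)
  refine exists_relation_coeff_zero_ne_zero (N := N) f
    (fun i => if hi : i < N + 1 then c ⟨i, hi⟩ else 0) ?_
    ⟨i₀, by omega, by simp only [i₀.2, dif_pos]; exact hi₀⟩ ?_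
  · intro i
    split_ifs
    · exact hcdeg _
    · simpa using hH
  · rw [Finset.sum_range]
    simp only [Fin.is_lt, dif_pos]
    exact hc

/-! ### Lifting from `𝔽_p(z)` to `ℚ(z)` -/

/-- A ring homomorphism applied to the coefficients of Laurent series. -/
def laurentMap {R S : Type*} [Ring R] [Ring S] (φ : R →+* S) :
    LaurentSeries R →+* LaurentSeries S where
  toFun x := HahnSeries.map x φ
  map_one' := HahnSeries.map_one φ.toMonoidWithZeroHom
  map_mul' _ _ := HahnSeries.map_mul (φ : R →ₙ+* S)
  map_zero' := HahnSeries.map_zero (φ : ZeroHom R S)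
  map_add' _ _ := HahnSeries.map_add (φ : R →+ S)

theorem coeff_laurentMap {R S : Type*} [Ring R] [Ring S] (φ : R →+* S) (x : LaurentSeries R)
    (k : ℤ) : (laurentMap φ x).coeff k = φ (x.coeff k) := rfl

theorem laurentMap_ofPowerSeries {R S : Type*} [Ring R] [Ring S] (φ : R →+* S)
    (g : PowerSeries R) : laurentMap φ (HahnSeries.ofPowerSeries ℤ R g) =
      HahnSeries.ofPowerSeries ℤ S (PowerSeries.map φ g) := by
  ext k
  rw [coeff_laurentMap, PowerSeries.coeff_coe, PowerSeries.coeff_coe]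
  split_ifs
  · exact map_zero φ
  · rw [PowerSeries.coeff_map]

theorem laurentMap_polynomial {R S : Type*} [CommRing R] [CommRing S] (φ : R →+* S) (g : R[X]) :
    laurentMap φ (HahnSeries.ofPowerSeries ℤ R (g : PowerSeries R)) =
      HahnSeries.ofPowerSeries ℤ S ((g.map φ : S[X]) : PowerSeries S) := by
  rw [laurentMap_ofPowerSeries, Polynomial.polynomial_map_coe]

theorem ofPowerSeries_polynomial {F : Type*} [Field F] (P : F[X]) :
    HahnSeries.ofPowerSeries ℤ F (P : PowerSeries F) =
      ((algebraMap F[X] (RatFunc F) P : RatFunc F) : LaurentSeries F) :=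
  RatFunc.coe_coe P

section Reduction

variable {p : ℕ} [hp : Fact p.Prime]

/-- Laurent series over `ℤ_(p)` regarded over `ℚ`. -/
abbrev toRatLaurent (p : ℕ) [Fact p.Prime] :
    LaurentSeries (zLocalSubring p) →+* LaurentSeries ℚ :=
  laurentMap (zLocalSubring p).subtype

theorem isIntegralLaurent_toRatLaurent (x : LaurentSeries (zLocalSubring p)) :
    IsIntegralLaurent p (toRatLaurent p x) := fun k => (x.coeff k).2

theorem redLaurent_toRatLaurent (x : LaurentSeries (zLocalSubring p)) :
    redLaurent p (toRatLaurent p x) = laurentMap (reduction p) x := rfl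

theorem isZeroMod_toRatLaurent (x : LaurentSeries (zLocalSubring p))
    (hx : laurentMap (reduction p) x = 0) : IsZeroMod p (toRatLaurent p x) := by
  have hp0 : (p : ℚ) ≠ 0 := by exact_mod_cast hp.out.ne_zero
  intro k
  refine ⟨(x.coeff k : ℚ) / p, div_mem_zLocal (x.coeff k).2 ?_, ?_⟩
  · exact congrArg (fun y => HahnSeries.coeff y k) hx
  · rw [mul_div_cancel₀ _ hp0]; rfl

theorem reduction_surjective : Function.Surjective (reduction p) := fun x =>
  ⟨⟨(x.val : ℚ), natCast_mem_zLocal _⟩, by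
    simp only [reduction, RingHom.coe_mk, MonoidHom.coe_mk, OneHom.coe_mk, Rat.cast_natCast,
      ZMod.natCast_zmod_val]⟩

theorem isUnit_of_reduction_ne_zero {x : zLocalSubring p} (hx : reduction p x ≠ 0) :
    IsUnit x := by
  have hx0 : (x : ℚ) ≠ 0 := fun h => hx (by rw [show x = 0 from Subtype.ext h, map_zero])
  exact IsUnit.of_mul_eq_one ⟨(x : ℚ)⁻¹, inv_mem_zLocal x.2 hx⟩
    (Subtype.ext (mul_inv_cancel₀ hx0))

theorem exists_lift_polynomial (s : (ZMod p)[X]) :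
    ∃ s' : (zLocalSubring p)[X], s'.map (reduction p) = s ∧ s'.natDegree = s.natDegree := by
  exact exists_natDegree_eq_of_mem_lifts
    ((mem_lifts (f := reduction p) s).2 (map_surjective _ reduction_surjective s))

theorem ratHeight_div_lt {F : Type*} [Field F] {s t : F[X]} (ht : t ≠ 0) {H : ℕ}
    (hs : s.natDegree < H) (htH : t.natDegree < H) :
    ratHeight (algebraMap F[X] (RatFunc F) s / algebraMap F[X] (RatFunc F) t) < H := by
  rw [ratHeight, max_lt_iff]
  constructor
  · rcases eq_or_ne s 0 with rfl | hs0
    · simpa using (Nat.zero_le _).trans_lt hs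
    · exact (natDegree_le_of_dvd (RatFunc.num_div_dvd s ht) hs0).trans_lt hs
  · exact (natDegree_le_of_dvd (RatFunc.denom_div_dvd s t) ht).trans_lt htH

/-- A rational function `s / t` over `𝔽_p` lifts to a rational function over `ℚ` with expansion
in `ℤ_(p)[[z]][z⁻¹]`: lift `t = zᵏ u`, `u(0) ≠ 0`, to `zᵏ ũ`; then `ũ` is a unit of
`ℤ_(p)[[z]]`. -/
theorem exists_lift_ratFunc (s : (ZMod p)[X]) {t : (ZMod p)[X]} (ht : t ≠ 0) :
    ∃ (q : RatFunc ℚ) (x : LaurentSeries (zLocalSubring p)),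
      (q : LaurentSeries ℚ) = toRatLaurent p x ∧
      laurentMap (reduction p) x =
        ((algebraMap _ (RatFunc (ZMod p)) s / algebraMap _ (RatFunc (ZMod p)) t :
          RatFunc (ZMod p)) : LaurentSeries (ZMod p)) := by
  obtain ⟨s', hs', -⟩ := exists_lift_polynomial s
  obtain ⟨u, htu, hu⟩ := exists_eq_pow_rootMultiplicity_mul_and_not_dvd t ht 0
  set k := t.rootMultiplicity 0
  rw [C_0, sub_zero] at htu hu
  rw [X_dvd_iff] at hu
  obtain ⟨u', hu', -⟩ := exists_lift_polynomial u
  have hunit : IsUnit (u' : PowerSeries (zLocalSubring p)) := by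
    rw [PowerSeries.isUnit_iff_constantCoeff]
    refine isUnit_of_reduction_ne_zero ?_
    rwa [← hu', coeff_map, ← Polynomial.coeff_coe, PowerSeries.coeff_zero_eq_constantCoeff] at hu
  obtain ⟨v, hv⟩ := hunit.exists_right_inv
  set x : LaurentSeries (zLocalSubring p) :=
    HahnSeries.ofPowerSeries ℤ _ ((s' : PowerSeries (zLocalSubring p)) * v) *
      HahnSeries.single (-(k : ℤ)) 1 with hx
  have hX : HahnSeries.single (-(k : ℤ)) (1 : zLocalSubring p) *
      HahnSeries.ofPowerSeries ℤ _ ((X ^ k : (zLocalSubring p)[X]) :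
        PowerSeries (zLocalSubring p)) = 1 := by
    rw [Polynomial.coe_pow, Polynomial.coe_X, HahnSeries.ofPowerSeries_X_pow,
      HahnSeries.single_mul_single]
    simp
  have hxt : x * HahnSeries.ofPowerSeries ℤ _ ((X ^ k * u' : (zLocalSubring p)[X]) :
      PowerSeries (zLocalSubring p)) =
      HahnSeries.ofPowerSeries ℤ _ (s' : PowerSeries (zLocalSubring p)) := by
    have e : x * HahnSeries.ofPowerSeries ℤ _ ((X ^ k * u' : (zLocalSubring p)[X]) :
        PowerSeries (zLocalSubring p)) =
      HahnSeries.ofPowerSeries ℤ _ ((s' : PowerSeries (zLocalSubring p)) *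
        ((u' : PowerSeries (zLocalSubring p)) * v)) *
      (HahnSeries.single (-(k : ℤ)) (1 : zLocalSubring p) *
        HahnSeries.ofPowerSeries ℤ _ ((X ^ k : (zLocalSubring p)[X]) :
          PowerSeries (zLocalSubring p))) := by
      rw [hx, Polynomial.coe_mul]
      simp only [map_mul]
      ring
    rw [e, hv, hX, mul_one, mul_one]
  have himage : ∀ {F : Type} [Field F] (φ : zLocalSubring p →+* F),
      (X ^ k * u').map φ ≠ 0 → laurentMap φ x =
        ((algebraMap _ (RatFunc F) (s'.map φ) / algebraMap _ (RatFunc F) ((X ^ k * u').map φ) :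
          RatFunc F) : LaurentSeries F) := by
    intro F _ φ h0
    have h := congrArg (laurentMap φ) hxt
    rw [map_mul, laurentMap_polynomial, laurentMap_polynomial, ofPowerSeries_polynomial,
      ofPowerSeries_polynomial] at h
    rw [map_div₀, eq_div_iff, h]
    rw [Ne, map_eq_zero]
    exact (map_ne_zero_iff _ (RatFunc.algebraMap_injective F)).2 h0
  refine ⟨_, x, (himage (zLocalSubring p).subtype ?_).symm, ?_⟩
  · rw [Polynomial.map_mul, Polynomial.map_pow, map_X]
    refine mul_ne_zero (pow_ne_zero _ X_ne_zero) ?_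
    rw [Ne, Polynomial.map_eq_zero_iff (Subring.subtype_injective _)]
    rintro rfl
    rw [Polynomial.map_zero] at hu'
    rw [← hu', coeff_zero] at hu
    exact hu rfl
  · have e : (X ^ k * u').map (reduction p) = t := by
      rw [Polynomial.map_mul, Polynomial.map_pow, map_X, hu', ← htu]
    rw [himage (reduction p) (by rwa [e]), e, hs']

/-- Lifting a Frobenius relation over `𝔽_p(z)` to a congruence with coefficients in `ℚ(z)`. -/
theorem exists_lift_relation {l N H : ℕ} (g : PowerSeries (zLocalSubring p))
    (e : ℕ → (ZMod p)[X]) (he0 : e 0 ≠ 0) (hdeg : ∀ i, (e i).natDegree < H)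
    (hrel : ∑ i ∈ Finset.range (N + 1),
      (e i : PowerSeries (ZMod p)) * PowerSeries.map (reduction p) g ^ p ^ (i * l) = 0) :
    ∃ Q : ℕ → RatFunc ℚ, (∀ i, IsIntegralOfHeightLT p (Q i) H) ∧
      IsZeroMod p (toRatLaurent p (HahnSeries.ofPowerSeries ℤ _ g) +
        ∑ i ∈ Finset.Icc 1 N, (Q i : LaurentSeries ℚ) *
          toRatLaurent p (HahnSeries.ofPowerSeries ℤ _ g) ^ p ^ (i * l)) := by
  choose q x hq hx using fun i => exists_lift_ratFunc (e i) he0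
  refine ⟨q, fun i => ⟨?_, _, ?_, ratHeight_div_lt he0 (hdeg i) (hdeg 0)⟩, ?_⟩
  · rw [hq]; exact isIntegralLaurent_toRatLaurent _
  · rw [hq, redLaurent_toRatLaurent, hx]
  · simp only [hq, ← map_pow, ← map_mul, ← map_sum, ← map_add]
    refine isZeroMod_toRatLaurent _ ?_
    simp only [map_add, map_sum, map_mul, hx]
    have h0 : ((algebraMap _ (RatFunc (ZMod p)) (e 0) : RatFunc (ZMod p)) :
        LaurentSeries (ZMod p)) ≠ 0 := by
      rw [Ne, map_eq_zero]
      exact (map_ne_zero_iff _ (RatFunc.algebraMap_injective _)).2 he0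
    refine (mul_right_inj' h0).1 ?_
    rw [mul_zero, ← map_zero (HahnSeries.ofPowerSeries ℤ (ZMod p)), ← hrel, map_sum,
      Finset.range_eq_Ico, Finset.sum_eq_sum_Ico_succ_bot (Nat.succ_pos N), mul_add,
      Finset.mul_sum]
    congr 1
    · rw [map_mul, ofPowerSeries_polynomial, zero_mul, pow_zero, pow_one, laurentMap_ofPowerSeries]
    · refine Finset.sum_congr rfl fun i _ => ?_
      rw [map_mul, ofPowerSeries_polynomial, laurentMap_ofPowerSeries, map_pow, map_div₀, ← mul_assoc,
        mul_div_cancel₀ _ h0]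

end Reduction

/-- A Frobenius relation as a polynomial equation over `F(z)`. -/
theorem exists_annihilating_polynomial {F : Type*} [Field F] {p l N H : ℕ} (hp : 1 < p)
    (hl : 0 < l) (f : PowerSeries F) (e : ℕ → F[X]) (he0 : e 0 ≠ 0)
    (hdeg : ∀ i, (e i).natDegree < H)
    (hrel : ∑ i ∈ Finset.range (N + 1), (e i : PowerSeries F) * f ^ p ^ (i * l) = 0) :
    ∃ P : (RatFunc F)[X], P ≠ 0 ∧ P.natDegree ≤ p ^ (N * l) ∧ polyHeight P ≤ H ∧
      evalLaurent P (HahnSeries.ofPowerSeries ℤ F f) = 0 := by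
  have hinj : ∀ i j : ℕ, p ^ (i * l) = p ^ (j * l) → i = j := fun i j h =>
    Nat.eq_of_mul_eq_mul_right hl (Nat.pow_right_injective hp h)
  set P : (RatFunc F)[X] := ∑ i ∈ Finset.range (N + 1),
    monomial (p ^ (i * l)) (algebraMap F[X] (RatFunc F) (e i)) with hP
  have hcoeff : ∀ i ∈ Finset.range (N + 1),
      P.coeff (p ^ (i * l)) = algebraMap F[X] (RatFunc F) (e i) := by
    intro i hi
    rw [hP, finsetSum_coeff, Finset.sum_eq_single i]
    · rw [coeff_monomial, if_pos rfl]
    · intro j _ hj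
      rw [coeff_monomial, if_neg fun h => hj (hinj _ _ h)]
    · exact fun h => absurd hi h
  refine ⟨P, ?_, ?_, ?_, ?_⟩
  · intro h
    have h1 := hcoeff 0 (by simp)
    rw [h, coeff_zero, eq_comm, map_eq_zero_iff _ (RatFunc.algebraMap_injective F)] at h1
    exact he0 h1
  · refine natDegree_sum_le_of_forall_le _ _ fun i hi => (natDegree_monomial_le _).trans ?_
    exact Nat.pow_le_pow_right (by omega)
      (Nat.mul_le_mul_right _ (Nat.lt_succ_iff.1 (Finset.mem_range.1 hi)))
  · refine Finset.sup_le fun j _ => ?_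
    by_cases hj : ∃ i ∈ Finset.range (N + 1), p ^ (i * l) = j
    · obtain ⟨i, hi, rfl⟩ := hj
      rw [hcoeff i hi, ratHeight, RatFunc.num_algebraMap, RatFunc.denom_algebraMap]
      simpa using (hdeg i).le
    · rw [hP, finsetSum_coeff, Finset.sum_eq_zero]
      · simp [ratHeight]
      · intro i hi
        rw [coeff_monomial, if_neg fun h => hj ⟨i, hi, h⟩]
  · have h := congrArg (HahnSeries.ofPowerSeries ℤ F) hrel
    rw [map_sum, map_zero] at h
    rw [evalLaurent, hP, map_sum, ← h]
    refine Finset.sum_congr rfl fun i _ => ?_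
    rw [aeval_monomial, map_mul, map_pow, ofPowerSeries_polynomial]

/-! ### The relation for the hypergeometric series -/

theorem IsParam.of_den_dvd {d : ℕ} {γ : ℚ} (h0 : 0 < γ) (h1 : γ ≤ 1) (h : γ.den ∣ d) :
    IsParam d γ := by
  obtain ⟨c, rfl⟩ := h
  have hnum : 0 < γ.num := Rat.num_pos.2 h0
  have e : (γ.num : ℚ) = (γ.num.toNat : ℚ) := by
    conv_lhs => rw [← Int.toNat_of_nonneg hnum.le]
    rfl
  refine ⟨h0, h1, c * γ.num.toNat, ?_⟩
  push_cast
  rw [← e, mul_comm (γ.den : ℚ), mul_assoc, mul_comm (γ.den : ℚ), Rat.mul_den_eq_num]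

section

variable {p : ℕ} [hp : Fact p.Prime] {d n : ℕ} {α β : Fin n → ℚ}

theorem IsAdmissible.of_lt {hn : 0 < n}
    (hα : ∀ i, 0 < α i ∧ α i ≤ 1) (hβ : ∀ j, 0 < β j ∧ β j ≤ 1)
    (hβ_last : β ⟨n - 1, Nat.sub_lt hn Nat.one_pos⟩ = 1)
    (hαβ : ∀ i j, ∀ k : ℤ, α i - β j ≠ k) (hd : hypDenom α β < p)
    (hint : ∀ i, PowerSeries.coeff i (hypSeries α β) ∈ zLocal p) :
    IsAdmissible p (hypDenom α β) α β where
  d_pos := Nat.pos_of_ne_zero (Nat.lcm_ne_zero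
    (Finset.lcm_eq_zero_iff.not.2 fun ⟨i, _, hi⟩ => (α i).den_nz hi)
    (Finset.lcm_eq_zero_iff.not.2 fun ⟨i, _, hi⟩ => (β i).den_nz hi))
  d_lt := hd
  num k := IsParam.of_den_dvd (hα k).1 (hα k).2
    ((Finset.dvd_lcm (Finset.mem_univ k)).trans (Nat.dvd_lcm_left _ _))
  den k := IsParam.of_den_dvd (hβ k).1 (hβ k).2
    ((Finset.dvd_lcm (Finset.mem_univ k)).trans (Nat.dvd_lcm_right _ _))
  ne i j h := hαβ i j 0 (by simp [h])
  one := ⟨_, hβ_last⟩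
  int i := by simpa [hypSeries] using hint i

theorem card_unitExpSet_le : (unitExpSet α β p).card ≤ n := by
  classical
  have h1 : unitExpSet α β p ⊆ Finset.univ.image fun j => (1 - (β j : ZMod p)).val := by
    intro r hr
    rw [unitExpSet, Finset.mem_filter, expSet, Finset.mem_filter, Finset.mem_range] at hr
    obtain ⟨⟨hrp, j, hj⟩, -⟩ := hr
    exact Finset.mem_image.2 ⟨j, Finset.mem_univ _, by rw [← hj, ZMod.val_natCast_of_lt hrp]⟩
  exact (Finset.card_le_card h1).trans (Finset.card_image_le.trans (by simp))

/-- The series `∑ Q_{𝔇_p^m(α), 𝔇_p^m(β)}(a + p i) zⁱ mod p`. -/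
def frobSeries (p : ℕ) [Fact p.Prime] {n : ℕ} (α β : Fin n → ℚ) (m a : ℕ) :
    PowerSeries (ZMod p) :=
  PowerSeries.mk fun i => coeffMod p (fun k => (dwork p)^[m] (α k))
    (fun k => (dwork p)^[m] (β k)) (a + p * i)

namespace IsAdmissible

theorem iterate_dwork_num (h : IsAdmissible p d α β) {l : ℕ} (hl : (p : ZMod d) ^ l = 1) :
    (fun k => (HypMod.dwork p)^[l] (α k)) = α :=
  funext fun k => (h.num k).iterate_dwork_eq_self h.d_pos h.d_lt hl

theorem iterate_dwork_den (h : IsAdmissible p d α β) {l : ℕ} (hl : (p : ZMod d) ^ l = 1) :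
    (fun k => (HypMod.dwork p)^[l] (β k)) = β :=
  funext fun k => (h.den k).iterate_dwork_eq_self h.d_pos h.d_lt hl

theorem frobSeries_zero (h : IsAdmissible p d α β) {l : ℕ} (hl0 : 0 < l)
    (hl : (p : ZMod d) ^ l = 1) :
    frobSeries p α β (l - 1) 0 = PowerSeries.mk (coeffMod p α β) := by
  ext i
  have h' := h.iterate_dwork (l - 1)
  have e1 : (fun k => HypMod.dwork p ((HypMod.dwork p)^[l - 1] (α k))) = α := by
    conv_rhs => rw [← h.iterate_dwork_num hl]
    funext k
    rw [← Function.iterate_succ_apply' (HypMod.dwork p), Nat.succ_eq_add_one,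
      Nat.sub_add_cancel hl0]
  have e2 : (fun k => HypMod.dwork p ((HypMod.dwork p)^[l - 1] (β k))) = β := by
    conv_rhs => rw [← h.iterate_dwork_den hl]
    funext k
    rw [← Function.iterate_succ_apply' (HypMod.dwork p), Nat.succ_eq_add_one,
      Nat.sub_add_cancel hl0]
  have key := h'.hypCoeff_mul_prime i
  rw [e1, e2] at key
  rw [frobSeries, PowerSeries.coeff_mk, PowerSeries.coeff_mk, zero_add, coeffMod,
    key.cast_eq (h.int i), coeffMod]

/-- The series `f mod p` lies, for each `k`, in the span over `𝔽_p[z]` of the `p^{kl}`-th powers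
of a fixed family of `numUnitExp α β p (l - 1)` series. -/
theorem exists_combination (h : IsAdmissible p d α β) {l : ℕ} (hl0 : 0 < l)
    (hl : (p : ZMod d) ^ l = 1) (k : ℕ) :
    ∃ W : ℕ → (ZMod p)[X], (∀ a, (W a).natDegree < p ^ (k * l)) ∧
      PowerSeries.mk (coeffMod p α β) =
        ∑ a ∈ unitExpSet (fun i => (HypMod.dwork p)^[l - 1] (α i))
          (fun i => (HypMod.dwork p)^[l - 1] (β i)) p,
          (W a : PowerSeries (ZMod p)) * frobSeries p α β (l - 1) a ^ p ^ (k * l) := by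
  have h' := h.iterate_dwork (l - 1)
  have hk : (p : ZMod d) ^ (k * l) = 1 := by rw [mul_comm, pow_mul, hl, one_pow]
  refine eq_sum_mul_pow_of_sections _ _ _ _ fun r hr => ?_
  obtain ⟨a, ha, c, hc⟩ := h'.exists_iterate_section (k * l) h'.zero_mem_unitExpSet hr
  rw [h'.iterate_dwork_num hk, h'.iterate_dwork_den hk] at ha hc
  refine ⟨a, ha, c, fun m => ?_⟩
  rw [← h.frobSeries_zero hl0 hl, frobSeries, frobSeries, PowerSeries.coeff_mk,
    PowerSeries.coeff_mk, hc]

theorem exists_relation (h : IsAdmissible p d α β) {l : ℕ} (hl0 : 0 < l)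
    (hl : (p : ZMod d) ^ l = 1) :
    ∃ e : ℕ → (ZMod p)[X], e 0 ≠ 0 ∧
      (∀ i, (e i).natDegree <
        numUnitExp α β p (l - 1) * p ^ (numUnitExp α β p (l - 1) * l)) ∧
      ∑ i ∈ Finset.range (numUnitExp α β p (l - 1) + 1),
        (e i : PowerSeries (ZMod p)) * PowerSeries.mk (coeffMod p α β) ^ p ^ (i * l) = 0 :=
  exists_frobenius_relation _ ⟨0, (h.iterate_dwork (l - 1)).zero_mem_unitExpSet⟩ _ _
    (h.exists_combination hl0 hl)

/-- If the family consists of the series `f mod p` alone, then `f ≡ W f ^ q`. -/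
theorem exists_eq_mul_pow (h : IsAdmissible p d α β) {l : ℕ} (hl0 : 0 < l)
    (hl : (p : ZMod d) ^ l = 1) (hN : numUnitExp α β p (l - 1) = 1) :
    ∃ W : (ZMod p)[X], W.natDegree < p ^ l ∧ PowerSeries.mk (coeffMod p α β) =
      (W : PowerSeries (ZMod p)) * PowerSeries.mk (coeffMod p α β) ^ p ^ l := by
  obtain ⟨W, hdeg, hW⟩ := h.exists_combination hl0 hl 1
  obtain ⟨a, ha⟩ := Finset.card_eq_one.1 hN
  have h0 := (h.iterate_dwork (l - 1)).zero_mem_unitExpSet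
  rw [ha, Finset.mem_singleton] at h0
  rw [one_mul] at hdeg hW
  rw [ha, ← h0, Finset.sum_singleton, h.frobSeries_zero hl0 hl] at hW
  exact ⟨W 0, hdeg 0, hW⟩

/-- The hypergeometric series as a power series over `ℤ_(p)`. -/
def integralSeries (h : IsAdmissible p d α β) : PowerSeries (zLocalSubring p) :=
  PowerSeries.mk fun i => ⟨hypCoeff α β i, h.int i⟩

theorem toRatLaurent_integralSeries (h : IsAdmissible p d α β) :
    toRatLaurent p (HahnSeries.ofPowerSeries ℤ _ h.integralSeries) =
      HahnSeries.ofPowerSeries ℤ ℚ (hypSeries α β) := by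
  rw [laurentMap_ofPowerSeries]
  congr 1

theorem map_reduction_integralSeries (h : IsAdmissible p d α β) :
    PowerSeries.map (reduction p) h.integralSeries = PowerSeries.mk (coeffMod p α β) := rfl

theorem redLaurent_hypSeries (h : IsAdmissible p d α β) :
    redLaurent p (HahnSeries.ofPowerSeries ℤ ℚ (hypSeries α β)) =
      HahnSeries.ofPowerSeries ℤ _ (PowerSeries.mk (coeffMod p α β)) := by
  rw [← h.toRatLaurent_integralSeries, redLaurent_toRatLaurent, laurentMap_ofPowerSeries,
    h.map_reduction_integralSeries]

end IsAdmissible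

end

end HypMod

end


theorem theorem1p1 (n : ℕ) (hn : 0 < n) (α β : Fin n → ℚ)
    (hα : ∀ i, 0 < α i ∧ α i ≤ 1) (hβ : ∀ j, 0 < β j ∧ β j ≤ 1)
    (hβ_last : β ⟨n - 1, Nat.sub_lt hn Nat.one_pos⟩ = 1)
    (hαβ : ∀ i j, ∀ k : ℤ, α i - β j ≠ k)
    (S : Set ℕ) (hS : S.Infinite) (hS_prime : ∀ p ∈ S, p.Prime)
    (hS_denom : ∀ p ∈ S, ¬ p ∣ HypMod.hypDenom α β)
    (hS_int : ∀ p ∈ S, ∀ i, PowerSeries.coeff i (HypMod.hypSeries α β) ∈ HypMod.zLocal p) :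
    ∃ S' : Set ℕ, S'.Infinite ∧ S' ⊆ S ∧ (S \ S').Finite ∧
      ∀ (p : ℕ) [Fact p.Prime], p ∈ S' →
        ∀ (d l : ℕ) (f : LaurentSeries ℚ),
        d = HypMod.hypDenom α β → l = orderOf (p : ZMod d) →
        f = HahnSeries.ofPowerSeries ℤ ℚ (HypMod.hypSeries α β) →
        -- algebraicity of `f mod p`, with bounds for degree and height
        (∃ P : Polynomial (RatFunc (ZMod p)), P ≠ 0 ∧
          P.natDegree ≤ p ^ (2 * n * Nat.totient d) ∧
          HypMod.polyHeight P ≤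
            5 ^ n * Nat.factorial (n + 1) * p ^ (2 * (n + 1) * Nat.totient d) ∧
          HypMod.evalLaurent P (HypMod.redLaurent p f) = 0) ∧
        -- assertion (1)
        (HypMod.numUnitExp α β p (l - 1) = 1 →
          ∃ Q₁ : Polynomial ℚ, (∀ k, Q₁.coeff k ∈ HypMod.zLocal p) ∧ Q₁.natDegree < p ^ l ∧
            HypMod.IsZeroMod p
              (f + HahnSeries.ofPowerSeries ℤ ℚ (Q₁ : PowerSeries ℚ) * f ^ p ^ l)) ∧
        -- assertion (2)
        (HypMod.numUnitExp α β p (l - 1) = 2 →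
          ∃ Q₁ Q₂ : RatFunc ℚ,
            HypMod.IsIntegralOfHeightLT p Q₁ (2 * p ^ (2 * l)) ∧
            HypMod.IsIntegralOfHeightLT p Q₂ (2 * p ^ (2 * l)) ∧
            HypMod.IsZeroMod p
              (f + (Q₁ : LaurentSeries ℚ) * f ^ p ^ l
                + (Q₂ : LaurentSeries ℚ) * f ^ p ^ (2 * l))) ∧
        -- assertion (3)
        (∀ t : ℕ, 2 < t + 1 → HypMod.numUnitExp α β p (l - 1) = t + 1 →
          ∃ Q : ℕ → RatFunc ℚ,
            (∀ i ∈ Finset.Icc 1 (t + 1), HypMod.IsIntegralOfHeightLT p (Q i)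
              (5 ^ t * Nat.factorial (t + 1) * p ^ (2 * (t + 1) * l))) ∧
            HypMod.IsZeroMod p
              (f + ∑ i ∈ Finset.Icc 1 (t + 1),
                (Q i : LaurentSeries ℚ) * f ^ p ^ (i * l))) := by
  have hfin : (S \ {p | p ∈ S ∧ HypMod.hypDenom α β < p}).Finite := by
    refine (Set.finite_Iic (HypMod.hypDenom α β)).subset fun p hp => ?_
    by_contra hcon
    exact hp.2 ⟨hp.1, not_le.1 hcon⟩
  refine ⟨{p | p ∈ S ∧ HypMod.hypDenom α β < p}, ?_, fun p hp => hp.1, hfin, ?_⟩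
  · intro hcon
    exact hS ((hcon.union hfin).subset fun p hp => by
      by_cases h : p ∈ {p | p ∈ S ∧ HypMod.hypDenom α β < p}
      · exact Or.inl h
      · exact Or.inr ⟨hp, h⟩)
  intro p hpF hpS d l f hd hl hf
  have h : HypMod.IsAdmissible p d α β := by
    rw [hd]
    exact HypMod.IsAdmissible.of_lt (hn := hn) hα hβ hβ_last hαβ hpS.2 (hS_int p hpS.1)
  have hcop : Nat.Coprime p d :=
    (Nat.Prime.coprime_iff_not_dvd hpF.out).2 (hd ▸ hS_denom p hpS.1)
  have htot : (p : ZMod d) ^ Nat.totient d = 1 := by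
    have := congrArg Units.val (ZMod.pow_totient (ZMod.unitOfCoprime p hcop))
    rwa [Units.val_pow_eq_pow_val, ZMod.coe_unitOfCoprime, Units.val_one] at this
  have hφ : 0 < Nat.totient d := Nat.totient_pos.2 h.d_pos
  have hldvd : l ∣ Nat.totient d := hl ▸ orderOf_dvd_of_pow_eq_one htot
  have hl0 : 0 < l := Nat.pos_of_dvd_of_pos hldvd hφ
  have hlφ : l ≤ Nat.totient d := Nat.le_of_dvd hφ hldvd
  have hl1 : (p : ZMod d) ^ l = 1 := hl ▸ pow_orderOf_eq_one _
  have hp1 : 1 < p := hpF.out.one_lt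
  obtain ⟨e, he0, hdeg, hrel⟩ := h.exists_relation hl0 hl1
  have hNn : HypMod.numUnitExp α β p (l - 1) ≤ n := HypMod.card_unitExpSet_le
  set N := HypMod.numUnitExp α β p (l - 1)
  have hf' : f = HypMod.toRatLaurent p (HahnSeries.ofPowerSeries ℤ _ h.integralSeries) := by
    rw [hf, h.toRatLaurent_integralSeries]
  refine ⟨?_, ?_, ?_, ?_⟩
  · obtain ⟨P, hP0, hPdeg, hPh, hPe⟩ :=
      HypMod.exists_annihilating_polynomial hp1 hl0 _ e he0 hdeg hrel
    refine ⟨P, hP0, hPdeg.trans ?_, hPh.trans ?_, ?_⟩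
    · refine Nat.pow_le_pow_right hp1.le (Nat.mul_le_mul ?_ hlφ)
      omega
    · refine Nat.mul_le_mul ?_ (Nat.pow_le_pow_right hp1.le (Nat.mul_le_mul ?_ hlφ))
      · calc N ≤ 1 * (n + 1) := by omega
          _ ≤ 5 ^ n * Nat.factorial (n + 1) :=
            Nat.mul_le_mul (Nat.one_le_pow _ _ (by norm_num)) (Nat.self_le_factorial _)
      · omega
    · rw [hf, h.redLaurent_hypSeries, hPe]
  · intro hN
    obtain ⟨W, hWdeg, hW⟩ := h.exists_eq_mul_pow hl0 hl1 hN
    obtain ⟨V, hV, hVdeg⟩ := HypMod.exists_lift_polynomial (-W)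
    refine ⟨V.map (HypMod.zLocalSubring p).subtype, fun k => ?_, ?_, ?_⟩
    · rw [Polynomial.coeff_map]; exact (V.coeff k).2
    · refine Polynomial.natDegree_map_le.trans_lt ?_
      rwa [hVdeg, Polynomial.natDegree_neg]
    · rw [hf', ← HypMod.laurentMap_polynomial, ← map_pow, ← map_mul, ← map_add]
      refine HypMod.isZeroMod_toRatLaurent _ ?_
      rw [map_add, map_mul, map_pow, HypMod.laurentMap_polynomial,
        HypMod.laurentMap_ofPowerSeries, h.map_reduction_integralSeries, hV, ← map_pow, ← map_mul,
        ← map_add]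
      conv_lhs => rw [← Polynomial.coeToPowerSeries.ringHom_apply, map_neg,
        Polynomial.coeToPowerSeries.ringHom_apply, neg_mul, ← hW, add_neg_cancel]
      exact map_zero _
  · intro hN
    rw [hN] at hdeg hrel
    obtain ⟨Q, hQ, hz⟩ := HypMod.exists_lift_relation h.integralSeries e he0 hdeg hrel
    refine ⟨Q 1, Q 2, hQ 1, hQ 2, ?_⟩
    rw [← hf', show Finset.Icc 1 2 = {1, 2} from rfl, Finset.sum_pair (by norm_num), one_mul,
      ← add_assoc] at hz
    exact hz
  · intro t _ hN
    rw [hN] at hdeg hrel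
    have hbound : (t + 1) * p ^ ((t + 1) * l) ≤
        5 ^ t * Nat.factorial (t + 1) * p ^ (2 * (t + 1) * l) := by
      refine Nat.mul_le_mul ?_
        (Nat.pow_le_pow_right hp1.le (Nat.mul_le_mul_right _ (by omega)))
      calc t + 1 = 1 * (t + 1) := (one_mul _).symm
        _ ≤ 5 ^ t * Nat.factorial (t + 1) :=
          Nat.mul_le_mul (Nat.one_le_pow _ _ (by norm_num)) (Nat.self_le_factorial _)
    obtain ⟨Q, hQ, hz⟩ := HypMod.exists_lift_relation h.integralSeries e he0
      (fun i => (hdeg i).trans_le hbound) hrel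
    exact ⟨Q, fun i _ => hQ i, by rwa [← hf'] at hz⟩
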